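/- For integers $1\le k\le\mu$, a $k$-star on $\mu$ nodes is a graph whose node set consists of $k$ centres and $\mu-k$ leaves such that any two centres are adjacent, no two leaves are adjacent, every leaf is adjacent to exactly one centre, and the numbers of leaves adjacent to any two centres differ by at most one. The graph edit distance between two graphs $g$ and $h$ with the same number of nodes is the minimum number of edge additions and edge deletions that transform $g$ into a graph isomorphic to $h$. There is an algorithm which, given an integer $k\ge 1$ and (by its adjacency matrix) a finite simple graph $g$ with $\mu\ge k$ nodes, computes the graph edit distance between $g$ and a $k$-star on $\mu$ nodes, and which for every fixed $k$ runs in time $O(\mu^{k+2})$, where the constant depends only on $k$. Here the algorithm is a program for a random access machine which executes addition, truncated subtraction, multiplication, integer division, indirect loads and stores, and jumps at unit cost, and which for every fixed $k$ only ever stores numbers of $O(\log\mu)$ bits (that is, numbers bounded by a polynomial in $\mu$). -/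

import Mathlib

/-! ### k-stars -/

/-- `h` is a `k`-star: there are `k` centres, pairwise linked; the remaining nodes (the leaves) are
pairwise not linked; every leaf is linked to exactly one centre; and the numbers of leaves linked to
any two centres differ by at most one. -/
def IsKStar {V : Type*} (k : ℕ) (h : SimpleGraph V) : Prop :=
  ∃ S : Finset V, S.card = k ∧
    (∀ c ∈ S, ∀ d ∈ S, c ≠ d → h.Adj c d) ∧
    (∀ u, u ∉ S → ∀ v, v ∉ S → ¬ h.Adj u v) ∧
    (∀ u, u ∉ S → ∃! c, c ∈ S ∧ h.Adj c u) ∧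
    (∀ c ∈ S, ∀ d ∈ S,
      {u | u ∉ S ∧ h.Adj c u}.ncard ≤ {u | u ∉ S ∧ h.Adj d u}.ncard + 1)

/-- `k`-stars exist on any number `μ ≥ k` of nodes. -/
theorem exists_isKStar {k μ : ℕ} (hk : 1 ≤ k) (hμ : k ≤ μ) :
    ∃ h : SimpleGraph (Fin μ), IsKStar k h := by
  let h : SimpleGraph (Fin μ) := SimpleGraph.fromRel fun i j =>
    (i : ℕ) < k ∧ ((j : ℕ) < k ∨ (j : ℕ) % k = i)
  have hadj : ∀ c u : Fin μ, (c : ℕ) < k → ¬ (u : ℕ) < k → (h.Adj c u ↔ (u : ℕ) % k = c) := by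
    intro c u hc hu
    have : c ≠ u := by rintro rfl; exact hu hc
    simp only [h, SimpleGraph.fromRel_adj]
    tauto
  refine ⟨h, Finset.univ.filter fun i : Fin μ => (i : ℕ) < k, ?_, ?_, ?_, ?_, ?_⟩
  · rw [Fin.card_filter_val_lt]
    omega
  · intro c hc d hd hne
    simp only [Finset.mem_filter, Finset.mem_univ, true_and] at hc hd
    exact ⟨hne, Or.inl ⟨hc, Or.inl hd⟩⟩
  · intro u hu v hv
    simp only [Finset.mem_filter, Finset.mem_univ, true_and] at hu hv
    simp only [h, SimpleGraph.fromRel_adj]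
    tauto
  · intro u hu
    simp only [Finset.mem_filter, Finset.mem_univ, true_and] at hu ⊢
    have hm : (u : ℕ) % k < k := Nat.mod_lt _ hk
    refine ⟨⟨(u : ℕ) % k, hm.trans_le hμ⟩, ⟨hm, (hadj _ _ hm hu).2 rfl⟩, ?_⟩
    rintro c ⟨hc, hcu⟩
    exact Fin.ext ((hadj _ _ hc hu).1 hcu).symm
  · intro c hc d hd
    simp only [Finset.mem_filter, Finset.mem_univ, true_and] at hc hd ⊢
    set A := {u : Fin μ | ¬ (u : ℕ) < k ∧ h.Adj c u}
    set B := {u : Fin μ | ¬ (u : ℕ) < k ∧ h.Adj d u}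
    have key : (A \ {u | (u : ℕ) = c + k}).ncard ≤ B.ncard := by
      have e : ∀ u ∈ A \ {u | (u : ℕ) = c + k}, (u : ℕ) % k = c ∧ c + 2 * k ≤ (u : ℕ) := by
        rintro u ⟨⟨hu, hcu⟩, hne⟩
        have h1 := (hadj _ _ hc hu).1 hcu
        have h2 := Nat.div_add_mod (u : ℕ) k
        refine ⟨h1, ?_⟩
        have h3 : 2 ≤ (u : ℕ) / k := by
          by_contra hlt
          have : (u : ℕ) / k = 0 ∨ (u : ℕ) / k = 1 := by
            generalize (u : ℕ) / k = m at hlt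
            omega
          rcases this with h0 | h0
          · rw [h0] at h2; omega
          · rw [h0] at h2; exact hne (by simp only [Set.mem_ofPred_eq]; omega)
        nlinarith
      refine Set.ncard_le_ncard_of_injOn
        (fun u => if hu : (u : ℕ) - c - k + d < μ then ⟨(u : ℕ) - c - k + d, hu⟩ else u) ?_ ?_
      · intro u hu
        obtain ⟨h1, h2⟩ := e u hu
        have hlt : (u : ℕ) - c - k + d < μ := by omega
        simp only [hlt, dif_pos]
        have hk' : ¬ ((u : ℕ) - c - k + d) < k := by omega
        refine ⟨hk', (hadj _ _ hd hk').2 ?_⟩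
        have h3 := Nat.div_add_mod (u : ℕ) k
        have h4 : (u : ℕ) - c - k + d = d + k * ((u : ℕ) / k - 1) := by
          rw [Nat.mul_sub]; omega
        change ((u : ℕ) - c - k + d) % k = d
        rw [h4, Nat.add_mul_mod_self_left, Nat.mod_eq_of_lt hd]
      · intro u hu v hv huv
        obtain ⟨_, h2⟩ := e u hu
        obtain ⟨_, h4⟩ := e v hv
        have hlt : (u : ℕ) - c - k + d < μ := by omega
        have hlt' : (v : ℕ) - c - k + d < μ := by omega
        simp only [hlt, hlt', dif_pos, Fin.mk.injEq] at huv
        exact Fin.ext (by omega)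
    have h1 : ({u : Fin μ | (u : ℕ) = c + k}).ncard ≤ 1 := by
      rw [Set.ncard_le_one_iff]
      intro a b ha hb
      exact Fin.ext (ha.trans hb.symm)
    have h2 := Set.ncard_le_ncard_sdiff_add_ncard A {u : Fin μ | (u : ℕ) = c + k}
    omega

/-! ### Graph edit distance -/

/-- `g'` arises from `g` by adding one missing link or deleting one existing link. -/
def EditStep {V : Type*} (g g' : SimpleGraph V) : Prop :=
  ∃ u v : V, u ≠ v ∧
    ((¬ g.Adj u v ∧ g' = g ⊔ SimpleGraph.edge u v) ∨
      (g.Adj u v ∧ g' = g \ SimpleGraph.edge u v))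

/-- `EditPath n g g'`: some sequence of exactly `n` link additions and deletions turns `g` into
`g'`. -/
inductive EditPath {V : Type*} : ℕ → SimpleGraph V → SimpleGraph V → Prop
  | refl (g : SimpleGraph V) : EditPath 0 g g
  | step {n : ℕ} {g g' g'' : SimpleGraph V} :
      EditStep g g' → EditPath n g' g'' → EditPath (n + 1) g g''

/-- `d` is the graph edit distance between `g` and `h`: the least number of link additions and
deletions that transform `g` into a graph isomorphic to `h`. -/
def IsGraphEditDistance {V W : Type*} (g : SimpleGraph V) (h : SimpleGraph W) (d : ℕ) : Prop :=
  IsLeast {n : ℕ | ∃ g' : SimpleGraph V, EditPath n g g' ∧ Nonempty (g' ≃g h)} d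

/-! ### Random access machines -/

namespace RAM

/-- Instructions of a random access machine with registers and an indirectly addressed memory. -/
inductive Instr
  /-- `reg a := n` -/
  | const (a n : ℕ)
  /-- `reg a := reg b + reg c` -/
  | add (a b c : ℕ)
  /-- `reg a := reg b - reg c`, which is `0` if `reg b < reg c` -/
  | sub (a b c : ℕ)
  /-- `reg a := reg b * reg c` -/
  | mul (a b c : ℕ)
  /-- `reg a := reg b / reg c`, rounded down, and `0` if `reg c = 0` -/
  | div (a b c : ℕ)
  /-- `reg a := mem (reg b)` -/
  | load (a b : ℕ)
  /-- `mem (reg a) := reg b` -/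
  | store (a b : ℕ)
  /-- go to line `l` -/
  | jmp (l : ℕ)
  /-- go to line `l` if `reg a = 0`, and to the next line otherwise -/
  | jz (a l : ℕ)

/-- A program is a finite list of instructions, on lines `0, 1, 2, …`. -/
abbrev Program := List Instr

/-- A configuration: the current line, the registers, and the memory. -/
structure Config where
  pc : ℕ
  reg : ℕ → ℕ
  mem : ℕ → ℕ

/-- Write `n` to register `a` and go to the next line. -/
def Config.setReg (s : Config) (a n : ℕ) : Config :=
  { s with pc := s.pc + 1, reg := Function.update s.reg a n }

/-- The effect of one instruction. -/
def Instr.exec (s : Config) : Instr → Config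
  | .const a n => s.setReg a n
  | .add a b c => s.setReg a (s.reg b + s.reg c)
  | .sub a b c => s.setReg a (s.reg b - s.reg c)
  | .mul a b c => s.setReg a (s.reg b * s.reg c)
  | .div a b c => s.setReg a (s.reg b / s.reg c)
  | .load a b => s.setReg a (s.mem (s.reg b))
  | .store a b => { s with pc := s.pc + 1, mem := Function.update s.mem (s.reg a) (s.reg b) }
  | .jmp l => { s with pc := l }
  | .jz a l => { s with pc := if s.reg a = 0 then l else s.pc + 1 }

/-- All numbers stored in the configuration are at most `B`. -/
def Config.Bounded (s : Config) (B : ℕ) : Prop :=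
  (∀ a, s.reg a ≤ B) ∧ (∀ a, s.mem a ≤ B)

/-- `HaltsIn P B t s f`: started in `s`, the program `P` executes exactly `t` instructions and then
halts (by reaching a line without an instruction) in the configuration `f`, and no number larger
than `B` is stored in any configuration of this run. -/
inductive HaltsIn (P : Program) (B : ℕ) : ℕ → Config → Config → Prop
  | halt {s : Config} : P[s.pc]? = none → s.Bounded B → HaltsIn P B 0 s s
  | step {t : ℕ} {s f : Config} {i : Instr} : P[s.pc]? = some i → s.Bounded B →
      HaltsIn P B t (i.exec s) f → HaltsIn P B (t + 1) s f

open Classical in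
/-- The start configuration on the input `(k, g)`: line `0`, `k` in register `0`, the number `μ` of
nodes in register `1`, the adjacency matrix of `g` stored row by row in the memory cells
`0, …, μ ^ 2 - 1`, and `0` everywhere else. -/
noncomputable def input (k : ℕ) {μ : ℕ} (g : SimpleGraph (Fin μ)) : Config where
  pc := 0
  reg := fun a => if a = 0 then k else if a = 1 then μ else 0
  mem := fun a => if ∃ i j : Fin μ, a = (i : ℕ) * μ + (j : ℕ) ∧ g.Adj i j then 1 else 0

end RAM

/-!
All copies of a `k`-star `h` have the same number of edges, so the distance of `g` to `h` is
`|E g| + |E h| - 2 m`, where `m` is the largest number of edges that `g` shares with a copy of `h`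
on its own nodes. A copy is given by its `k` centres and an assignment of prescribed numbers
`q i` of leaves to them. For fixed centres, by the deficiency version of Hall's theorem, the least
number of leaves that cannot be attached along an edge of `g` is the maximum over the `2 ^ k` sets
`T` of centres of `#{u | u has all its neighbouring centres in T} - ∑ i ∈ T, q i`. Each of these
numbers is computed in time linear in `μ`, and there are `μ ^ k` tuples of centres.
-/

/-! ### Edit paths -/

section EditPath

open scoped symmDiff

variable {V W : Type*}

theorem EditStep.exists_eq_symmDiff_edge {g g' : SimpleGraph V} (h : EditStep g g') :
    ∃ u v, g' = g ∆ SimpleGraph.edge u v := by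
  obtain ⟨u, v, -, ⟨huv, rfl⟩ | ⟨huv, rfl⟩⟩ := h
  · exact ⟨u, v, ((SimpleGraph.disjoint_edge g).2 huv).symmDiff_eq_sup.symm⟩
  · exact ⟨u, v, (symmDiff_of_ge ((SimpleGraph.edge_le_iff g).2 (.inr huv))).symm⟩

theorem editStep_symmDiff_edge (g : SimpleGraph V) {u v : V} (h : u ≠ v) :
    EditStep g (g ∆ SimpleGraph.edge u v) := by
  by_cases huv : g.Adj u v
  · exact ⟨u, v, h, .inr ⟨huv, symmDiff_of_ge ((SimpleGraph.edge_le_iff g).2 (.inr huv))⟩⟩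
  · exact ⟨u, v, h, .inl ⟨huv, ((SimpleGraph.disjoint_edge g).2 huv).symmDiff_eq_sup⟩⟩

theorem EditPath.ncard_edgeSet_symmDiff_le [Finite V] {n : ℕ} {g g' : SimpleGraph V}
    (h : EditPath n g g') : (g ∆ g').edgeSet.ncard ≤ n := by
  induction h with
  | refl => simp
  | @step n g g' g'' hstep _ ih =>
    obtain ⟨u, v, rfl⟩ := hstep.exists_eq_symmDiff_edge
    set e := SimpleGraph.edge u v
    have hle : g ∆ g'' ≤ g ∆ e ∆ g'' ⊔ e := calc
      g ∆ g'' = g ∆ e ∆ g'' ∆ e := by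
        rw [symmDiff_right_comm, symmDiff_symmDiff_cancel_right]
      _ ≤ g ∆ e ∆ g'' ⊔ e := symmDiff_le_sup
    calc (g ∆ g'').edgeSet.ncard
        ≤ (g ∆ e ∆ g'' ⊔ e).edgeSet.ncard :=
          Set.ncard_le_ncard (SimpleGraph.edgeSet_mono hle)
      _ ≤ (g ∆ e ∆ g'').edgeSet.ncard + e.edgeSet.ncard := by
          rw [SimpleGraph.edgeSet_sup]
          exact Set.ncard_union_le _ _
      _ ≤ n + 1 := Nat.add_le_add ih <| calc
          e.edgeSet.ncard ≤ ({s(u, v)} : Set (Sym2 V)).ncard :=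
            Set.ncard_le_ncard SimpleGraph.edgeSet_edge_subset
          _ = 1 := Set.ncard_singleton _

theorem editPath_ncard_edgeSet_symmDiff [Finite V] (g g' : SimpleGraph V) :
    EditPath (g ∆ g').edgeSet.ncard g g' := by
  induction hn : (g ∆ g').edgeSet.ncard generalizing g with
  | zero =>
    obtain rfl : g = g' := by
      rwa [Set.ncard_eq_zero, SimpleGraph.edgeSet_eq_empty, symmDiff_eq_bot] at hn
    exact .refl g
  | succ n ih =>
    obtain ⟨e, he⟩ := Set.nonempty_of_ncard_ne_zero (hn.trans_ne n.succ_ne_zero)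
    induction e with
    | h u v =>
      have hadj : (g ∆ g').Adj u v := he
      refine .step (editStep_symmDiff_edge g hadj.ne) (ih _ ?_)
      rw [symmDiff_right_comm, symmDiff_of_ge ((SimpleGraph.edge_le_iff _).2 (.inr hadj)),
        SimpleGraph.edgeSet_sdiff, SimpleGraph.edgeSet_edge_of_ne hadj.ne,
        Set.ncard_sdiff_singleton_of_mem he, hn, Nat.add_sub_cancel]

theorem isGraphEditDistance_of_isLeast [Finite V] {g : SimpleGraph V} {h : SimpleGraph W} {d : ℕ}
    (hd : IsLeast (Set.range fun e : W ≃ V => (g.comap e ∆ h).edgeSet.ncard) d) :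
    IsGraphEditDistance g h d := by
  have hcard (e : W ≃ V) :
      (g.comap e ∆ h).edgeSet.ncard = (g ∆ h.comap e.symm).edgeSet.ncard := by
    have hcomap : (g ∆ h.comap e.symm).comap e = g.comap e ∆ h := by
      ext u v
      simp [symmDiff_def]
    rw [← hcomap]
    exact Nat.card_congr (SimpleGraph.Iso.comap e _).mapEdgeSet
  simp only [hcard] at hd
  obtain ⟨⟨e, rfl⟩, hmin⟩ := hd
  refine ⟨⟨_, editPath_ncard_edgeSet_symmDiff g _, ⟨SimpleGraph.Iso.comap e.symm h⟩⟩, ?_⟩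
  rintro n ⟨g', hpath, ⟨φ⟩⟩
  have hg' : h.comap φ.toEquiv.symm.symm = g' := by
    ext u v
    exact φ.map_adj_iff
  refine (hmin ⟨φ.toEquiv.symm, rfl⟩).trans ?_
  simpa only [hg'] using hpath.ncard_edgeSet_symmDiff_le

theorem IsGraphEditDistance.congr_right {W' : Type*} {g : SimpleGraph V} {h : SimpleGraph W}
    {h' : SimpleGraph W'} {d : ℕ} (φ : h ≃g h') (hd : IsGraphEditDistance g h d) :
    IsGraphEditDistance g h' d := by
  have hiff (g' : SimpleGraph V) : Nonempty (g' ≃g h) ↔ Nonempty (g' ≃g h') :=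
    ⟨.map fun ψ => ψ.trans φ, .map fun ψ => ψ.trans φ.symm⟩
  simpa only [IsGraphEditDistance, hiff] using hd

end EditPath

/-! ### Counting edges -/

section Counting

open Finset
open scoped symmDiff

variable {V ι L : Type*}

theorem sum_sum_ite_adj [Fintype V] (G : SimpleGraph V) [DecidableRel G.Adj] :
    ∑ u, ∑ v, (if G.Adj u v then 1 else 0) = 2 * G.edgeSet.ncard := by
  simp only [← card_filter, Set.ncard_eq_toFinset_card', Set.toFinset_card,
    ← SimpleGraph.edgeFinset_card, ← SimpleGraph.sum_degrees_eq_twice_card_edges,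
    ← SimpleGraph.card_neighborFinset_eq_degree, SimpleGraph.neighborFinset_eq_filter]

theorem sum_sum_ite_adj_le [Fintype ι] (G : SimpleGraph V) [DecidableRel G.Adj] (c : ι → V) :
    ∑ i, ∑ j, (if G.Adj (c i) (c j) then 1 else 0) ≤ Fintype.card ι ^ 2 := calc
  ∑ i, ∑ j, (if G.Adj (c i) (c j) then 1 else 0) ≤ ∑ _ : ι, ∑ _ : ι, 1 :=
    sum_le_sum fun _ _ => sum_le_sum fun _ _ => ite_le_one le_rfl (Nat.zero_le 1)
  _ = Fintype.card ι ^ 2 := by simp [sq]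

theorem ncard_edgeSet_symmDiff_add [Finite V] (g h : SimpleGraph V) :
    (g ∆ h).edgeSet.ncard + 2 * (g ⊓ h).edgeSet.ncard =
      g.edgeSet.ncard + h.edgeSet.ncard := by
  have hunion := Set.ncard_union_add_ncard_inter g.edgeSet h.edgeSet
  have hsdiff := Set.ncard_sdiff_add_ncard_of_subset
    (Set.inter_subset_left.trans Set.subset_union_left : g.edgeSet ∩ h.edgeSet ⊆ _ ∪ h.edgeSet)
  rw [symmDiff_eq_sup_sdiff_inf, SimpleGraph.edgeSet_sdiff, SimpleGraph.edgeSet_sup,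
    SimpleGraph.edgeSet_inf]
  omega

/-- The graph with pairwise adjacent centres `i : ι` and leaves `x : L`, where the leaf `x` is
attached to the centre `a x`; a `k`-star is such a graph with `k` centres and a balanced `a`. -/
def multiStar (a : L → ι) : SimpleGraph (ι ⊕ L) where
  Adj
    | .inl i, .inl j => i ≠ j
    | .inl i, .inr x => a x = i
    | .inr x, .inl i => a x = i
    | .inr _, .inr _ => False
  symm := ⟨by
    rintro (i | x) (j | y) h
    exacts [Ne.symm h, h, h, h]⟩
  loopless := ⟨by
    rintro (i | x) h
    exacts [h rfl, h]⟩

theorem two_mul_ncard_edgeSet_inf_multiStar [Fintype ι] [Fintype L]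
    (G : SimpleGraph (ι ⊕ L)) [DecidableRel G.Adj] (a : L → ι) :
    2 * (G ⊓ multiStar a).edgeSet.ncard =
      ∑ i, ∑ j, (if G.Adj (.inl i) (.inl j) then 1 else 0) +
        2 * #{x | G.Adj (.inl (a x)) (.inr x)} := by
  classical
  have hcentre (i j : ι) : (G ⊓ multiStar a).Adj (.inl i) (.inl j) ↔ G.Adj (.inl i) (.inl j) :=
    and_iff_left_of_imp fun h => ne_of_apply_ne _ h.ne
  have hleft (i : ι) (x : L) :
      (G ⊓ multiStar a).Adj (.inl i) (.inr x) ↔ G.Adj (.inl (a x)) (.inr x) ∧ a x = i :=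
    and_congr_left fun h : a x = i => by rw [h]
  have hright (i : ι) (x : L) :
      (G ⊓ multiStar a).Adj (.inr x) (.inl i) ↔ G.Adj (.inl (a x)) (.inr x) ∧ a x = i := by
    rw [SimpleGraph.adj_comm, hleft]
  have hleaf (x y : L) : ¬ (G ⊓ multiStar a).Adj (.inr x) (.inr y) := fun h => h.2
  have hsum (x : L) : (∑ i, if G.Adj (.inl (a x)) (.inr x) ∧ a x = i then 1 else 0) =
      if G.Adj (.inl (a x)) (.inr x) then 1 else 0 := by
    simp only [ite_and, sum_ite_irrel, sum_ite_eq, mem_univ, if_true, sum_const_zero]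
  rw [← sum_sum_ite_adj]
  simp only [Fintype.sum_sum_type, hcentre, hleft, hright, hleaf, if_false, sum_const_zero,
    sum_add_distrib, add_zero]
  rw [sum_comm (s := (univ : Finset ι)) (t := (univ : Finset L))]
  simp only [hsum, card_filter]
  ring

theorem two_mul_ncard_edgeSet_multiStar [Fintype ι] [Fintype L] (a : L → ι) :
    2 * (multiStar a).edgeSet.ncard =
      Fintype.card ι * (Fintype.card ι - 1) + 2 * Fintype.card L := by
  classical
  have hne (i : ι) : (∑ j, if i ≠ j then 1 else 0) = Fintype.card ι - 1 := by
    rw [← card_filter, filter_ne, card_erase_of_mem (mem_univ i), card_univ]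
  have h := two_mul_ncard_edgeSet_inf_multiStar ⊤ a
  simpa only [top_inf_eq, SimpleGraph.top_adj, ne_eq, Sum.inl.injEq, hne, sum_const, card_univ,
    smul_eq_mul, reduceCtorEq, not_false_eq_true, filter_true] using h

end Counting

/-! ### k-stars as multistars -/

section KStar

open Finset

variable {V ι κ L : Type*} {k : ℕ}

/-- The size of the `j`-th part, `j < k`, when `n` is divided into `k` parts as evenly as possible,
the larger parts coming first. -/
def evenShare (n k j : ℕ) : ℕ := n / k + if j < n % k then 1 else 0

theorem sum_evenShare (hk : 1 ≤ k) (n : ℕ) : ∑ j : Fin k, evenShare n k j = n := by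
  simp only [evenShare, sum_add_distrib, sum_const, card_univ, Fintype.card_fin, smul_eq_mul,
    sum_boole, Fin.card_filter_val_lt, Nat.cast_id, min_eq_right (Nat.mod_lt n hk).le]
  exact Nat.div_add_mod n k

theorem exists_perm_forall_eq_evenShare {l : Fin k → ℕ} (hl : ∀ i j, l i ≤ l j + 1) :
    ∃ σ : Equiv.Perm (Fin k), ∀ j, l (σ j) = evenShare (∑ i, l i) k j := by
  rcases isEmpty_or_nonempty (Fin k) with _ | _
  · exact ⟨1, isEmptyElim⟩
  obtain ⟨i₀, hi₀⟩ := Finite.exists_min l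
  have hval (i : Fin k) : l i = l i₀ + if l i = l i₀ + 1 then 1 else 0 := by
    have hle := hl i i₀
    have hge := hi₀ i
    split_ifs <;> omega
  have hsum : ∑ i, l i = k * l i₀ + #{i | l i = l i₀ + 1} := by
    rw [sum_congr rfl fun i _ => hval i, sum_add_distrib, sum_const, card_univ, Fintype.card_fin,
      smul_eq_mul, ← card_filter]
  have hlt : #{i | l i = l i₀ + 1} < k := by
    simpa using card_lt_univ_of_notMem (s := {i | l i = l i₀ + 1}) (x := i₀) (by simp)
  have hdiv : (∑ i, l i) / k = l i₀ := by
    rw [hsum, Nat.mul_add_div (Nat.zero_lt_of_lt hlt), Nat.div_eq_of_lt hlt, add_zero]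
  have hmod : (∑ i, l i) % k = #{i | l i = l i₀ + 1} := by
    rw [hsum, Nat.mul_add_mod, Nat.mod_eq_of_lt hlt]
  have hcard : Fintype.card {j : Fin k // (j : ℕ) < (∑ i, l i) % k} =
      Fintype.card {i // l i = l i₀ + 1} := by
    rw [Fintype.card_subtype, Fintype.card_subtype, Fin.card_filter_val_lt, hmod,
      min_eq_right hlt.le]
  let e := Fintype.equivOfCardEq hcard
  refine ⟨e.extendSubtype, fun j => ?_⟩
  rw [evenShare, hdiv]
  split_ifs with hj
  · exact e.extendSubtype_mem j hj
  · rw [hval, if_neg (e.extendSubtype_not_mem j hj)]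

/-- Relabelling the centres of a multistar. -/
def multiStarIso (σ : ι ≃ κ) (a : L → ι) : multiStar a ≃g multiStar (σ ∘ a) where
  toEquiv := σ.sumCongr (.refl L)
  map_rel_iff' {p q} := by
    rcases p with i | x <;> rcases q with j | y
    exacts [σ.injective.ne_iff, σ.injective.eq_iff, σ.injective.eq_iff, .rfl]

theorem IsKStar.exists_multiStar_iso_of_le [Finite V] {h : SimpleGraph V} (hh : IsKStar k h) :
    ∃ (S : Finset V) (a : {u // u ∉ S} → Fin k),
      (∀ i j, {x | a x = i}.ncard ≤ {x | a x = j}.ncard + 1) ∧ Nonempty (multiStar a ≃g h) := by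
  classical
  obtain ⟨S, hS, hcentres, hleaves, hattach, hbalanced⟩ := hh
  choose! c hc hunique using hattach
  have hadj {u d : V} (hu : u ∉ S) (hd : d ∈ S) : h.Adj d u ↔ c u = d :=
    ⟨fun hdu => (hunique u hu d ⟨hd, hdu⟩).symm, fun hcu => hcu ▸ (hc u hu).2⟩
  let ε : S ≃ Fin k := S.equivFinOfCardEq hS
  let a : {u // u ∉ S} → S := fun x => ⟨c x, (hc x x.2).1⟩
  have ha (i : S) (x : {u // u ∉ S}) : a x = i ↔ h.Adj i x := by
    rw [hadj x.2 i.2, Subtype.ext_iff]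
  have hfibre (j : Fin k) :
      {x | (ε ∘ a) x = j}.ncard = {u | u ∉ S ∧ h.Adj (ε.symm j) u}.ncard := by
    rw [← Set.ncard_image_of_injective _ Subtype.val_injective]
    congr 1
    ext u
    simp [← Equiv.eq_symm_apply, ha, and_comm]
  refine ⟨S, ε ∘ a, fun i j => ?_, ⟨(multiStarIso ε a).symm.trans ⟨.sumCompl (· ∈ S), ?_⟩⟩⟩
  · rw [hfibre, hfibre]
    exact hbalanced _ (ε.symm i).2 _ (ε.symm j).2
  · rintro (i | x) (j | y)
    · exact ⟨fun hij => Subtype.coe_ne_coe.1 hij.ne,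
        fun hij => hcentres _ i.2 _ j.2 (Subtype.coe_ne_coe.2 hij)⟩
    · exact (ha i y).symm
    · exact (h.adj_comm _ _).trans (ha j x).symm
    · exact iff_of_false (hleaves _ x.2 _ y.2) id

theorem IsKStar.exists_multiStar_iso [Fintype V] {h : SimpleGraph V} (hh : IsKStar k h) :
    ∃ (S : Finset V) (a : {u // u ∉ S} → Fin k),
      (∀ j, {x | a x = j}.ncard = evenShare (Fintype.card V - k) k j) ∧
        Nonempty (multiStar a ≃g h) := by
  classical
  obtain ⟨S, a, hle, ⟨φ⟩⟩ := hh.exists_multiStar_iso_of_le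
  obtain ⟨σ, hσ⟩ := exists_perm_forall_eq_evenShare hle
  have hcard : ∑ j, {x | a x = j}.ncard = Fintype.card V - k := by
    have hsum := card_eq_sum_card_fiberwise (f := a) (s := univ) (t := univ) (by simp)
    have hV := Fintype.card_congr φ.toEquiv
    simp only [Fintype.card_sum, Fintype.card_fin] at hV
    simp only [Set.ncard_eq_toFinset_card', Set.toFinset_ofPred, ← hsum, card_univ]
    omega
  refine ⟨S, σ.symm ∘ a, fun j => ?_, ⟨(multiStarIso σ.symm a).symm.trans φ⟩⟩
  simp only [← hcard, ← hσ, Function.comp_apply, Equiv.symm_apply_eq]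

end KStar

/-! ### Attaching the leaves -/

section Deficiency

open Finset

variable {V α β ι L : Type*}

theorem exists_equiv_card_notMem_le [Fintype α] [Fintype β] [DecidableEq β]
    (hcard : Fintype.card α = Fintype.card β) {t : α → Finset β} {d : ℕ}
    (ht : ∀ A : Finset α, #A ≤ #(A.biUnion t) + d) :
    ∃ ψ : α ≃ β, #{x | ψ x ∉ t x} ≤ d := by
  classical
  let t' : α → Finset (β ⊕ Fin d) := fun x => (t x).disjSum univ
  have hhall (A : Finset α) : #A ≤ #(A.biUnion t') := by
    rcases A.eq_empty_or_nonempty with rfl | ⟨x₀, hx₀⟩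
    · exact Nat.zero_le _
    calc #A ≤ #(A.biUnion t) + d := ht A
      _ = #((A.biUnion t).disjSum (univ : Finset (Fin d))) := by simp
      _ = #(A.biUnion t') := by
        congr 1
        ext (y | z)
        · simp [t']
        · simpa [t'] using ⟨x₀, hx₀⟩
  obtain ⟨f, hf, hft⟩ := (all_card_le_biUnion_card_iff_exists_injective t').1 hhall
  let A : Finset α := {x | (f x).isRight}
  have hA : #A ≤ d := by
    have hmaps : Set.MapsTo f A ((univ : Finset (Fin d)).map .inr : Finset (β ⊕ Fin d)) := by
      intro x hx
      obtain ⟨z, hz⟩ := Sum.isRight_iff.1 (mem_filter.1 hx).2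
      simp [hz]
    simpa using card_le_card_of_injOn f hmaps hf.injOn
  let y (x : α) : β := (f x).elim id fun _ => Fintype.equivOfCardEq hcard x
  have hfy (x : α) (hx : x ∈ Aᶜ) : f x = .inl (y x) := by
    obtain ⟨y', hy'⟩ := Sum.isLeft_iff.1 (by simpa [A] using hx)
    simp [y, hy']
  have hy (x : α) (hx : x ∈ Aᶜ) : y x ∈ t x := by
    simpa [t', hfy x hx] using hft x
  have hinj : Set.InjOn y (Aᶜ : Finset α) := fun x hx x' hx' h =>
    hf (by rw [hfy x hx, hfy x' hx', h])
  obtain ⟨ψ, hψ⟩ := exists_equiv_extend_of_card_eq (t := (univ : Finset β)) (by simp [hcard])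
    (subset_univ (image y Aᶜ)) hinj
  refine ⟨ψ.trans (Equiv.subtypeUnivEquiv mem_univ), (card_le_card fun x hx => ?_).trans hA⟩
  by_contra hxA
  have hmem := hy x (mem_compl.2 hxA)
  rw [← hψ x (mem_compl.2 hxA)] at hmem
  exact (mem_filter.1 hx).2 hmem

/-- The deficiency of the assignment problem in which the vertices of `g` off the centres `c` are to
be attached to the centres, `q i` of them to `c i` and as many as possible along edges of `g`: among
the vertices whose neighbouring centres all lie in `T`, at most `∑ i ∈ T, q i` are attached along an
edge. -/
def starDeficiency [Fintype V] [DecidableEq V] [Fintype ι] [DecidableEq ι] (g : SimpleGraph V)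
    [DecidableRel g.Adj] (c : ι → V) (q : ι → ℕ) : ℕ :=
  univ.sup fun T : Finset ι =>
    #{u | u ∉ Set.range c ∧ ∀ i, g.Adj u (c i) → i ∈ T} - ∑ i ∈ T, q i

theorem card_filter_mem_eq_sum [Fintype L] [DecidableEq ι] {a : L → ι} {q : ι → ℕ}
    (ha : ∀ i, {x | a x = i}.ncard = q i) (T : Finset ι) :
    #{x | a x ∈ T} = ∑ i ∈ T, q i := by
  rw [card_eq_sum_card_fiberwise (f := a) (t := T) fun x hx => by simpa using hx]
  refine sum_congr rfl fun i hi => ?_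
  rw [← ha, Set.ncard_eq_toFinset_card', Set.toFinset_ofPred, filter_filter]
  congr 1
  ext x
  simp only [mem_filter_univ, and_iff_right_iff_imp]
  rintro rfl
  exact hi

variable [Fintype V] [DecidableEq V] [Fintype ι] [DecidableEq ι] [Fintype L]
  {g : SimpleGraph V} [DecidableRel g.Adj] {a : L → ι} {q : ι → ℕ}

theorem starDeficiency_le (ha : ∀ i, {x | a x = i}.ncard = q i) (e : ι ⊕ L ≃ V) :
    starDeficiency g (e ∘ .inl) q ≤ #{x | ¬ g.Adj (e (.inl (a x))) (e (.inr x))} := by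
  classical
  refine Finset.sup_le fun T _ => Nat.sub_le_iff_le_add.2 ?_
  rw [← card_filter_mem_eq_sum ha T]
  refine le_trans (card_le_card_of_injOn e.symm ?_ e.symm.injective.injOn)
    ((card_map .inr).trans_le (card_union_le _ _))
  intro u hu
  obtain ⟨hrange, hT⟩ := (mem_filter.1 hu).2
  obtain ⟨p, rfl⟩ := e.surjective u
  rcases p with i | x
  · exact absurd ⟨i, rfl⟩ hrange
  · have hx : ¬ g.Adj (e (.inl (a x))) (e (.inr x)) ∨ a x ∈ T := by
      rw [g.adj_comm, ← imp_iff_not_or]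
      exact hT (a x)
    simpa using hx

theorem exists_equiv_card_le_starDeficiency (ha : ∀ i, {x | a x = i}.ncard = q i)
    (hcard : Fintype.card ι + Fintype.card L = Fintype.card V) {c : ι → V}
    (hc : Function.Injective c) :
    ∃ e : ι ⊕ L ≃ V, e ∘ .inl = c ∧
      #{x | ¬ g.Adj (e (.inl (a x))) (e (.inr x))} ≤ starDeficiency g c q := by
  classical
  let t (u : {u // u ∉ Set.range c}) : Finset L := {x | g.Adj u (c (a x))}
  have hcard' : Fintype.card {u // u ∉ Set.range c} = Fintype.card L := by
    rw [Fintype.card_subtype_compl, ← hcard, ← Fintype.card_congr (Equiv.ofInjective c hc),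
      Nat.add_sub_cancel_left]
  have ht (A : Finset {u // u ∉ Set.range c}) : #A ≤ #(A.biUnion t) + starDeficiency g c q := by
    let T : Finset ι := {i | ∃ u ∈ A, g.Adj u (c i)}
    have hA : #A ≤ #{u | u ∉ Set.range c ∧ ∀ i, g.Adj u (c i) → i ∈ T} := by
      refine card_le_card_of_injOn (↑) (fun u hu => ?_) Subtype.val_injective.injOn
      exact mem_coe.2 (mem_filter_univ _ |>.2 ⟨u.2, fun i hi => mem_filter_univ _ |>.2 ⟨u, hu, hi⟩⟩)
    have hunion : A.biUnion t = ({x | a x ∈ T} : Finset L) := by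
      ext x
      simp [t, T]
    rw [hunion, card_filter_mem_eq_sum ha T, ← Nat.sub_le_iff_le_add']
    exact (Nat.sub_le_sub_right hA _).trans (le_sup (f := fun T : Finset ι =>
      #{u | u ∉ Set.range c ∧ ∀ i, g.Adj u (c i) → i ∈ T} - ∑ i ∈ T, q i) (mem_univ T))
  obtain ⟨ψ, hψ⟩ := exists_equiv_card_notMem_le hcard' ht
  refine ⟨((Equiv.ofInjective c hc).sumCongr ψ.symm).trans (.sumCompl (· ∈ Set.range c)), rfl,
    le_trans (card_equiv ψ.symm fun x => ?_).le hψ⟩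
  simp [t, g.adj_comm]

end Deficiency

/-! ### The edit distance to a multistar -/

section EditDistance

open Finset
open scoped symmDiff

variable {V ι L : Type*}

/-- Twice the largest number of edges that `g` shares with a multistar whose centres are placed on
the distinct vertices `c i` and have `q i` leaves each. -/
def starOverlap [Fintype V] [DecidableEq V] [Fintype ι] [DecidableEq ι] (g : SimpleGraph V)
    [DecidableRel g.Adj] (c : ι → V) (q : ι → ℕ) : ℕ :=
  ∑ i, ∑ j, (if g.Adj (c i) (c j) then 1 else 0) + 2 * (∑ i, q i - starDeficiency g c q)

/-- The largest `starOverlap` over all choices of distinct centres. -/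
def maxStarOverlap [Fintype V] [DecidableEq V] [Fintype ι] [DecidableEq ι] (g : SimpleGraph V)
    [DecidableRel g.Adj] (q : ι → ℕ) : ℕ :=
  univ.sup fun c : ι → V => if c.Injective then starOverlap g c q else 0

variable [Fintype ι] [Fintype L] {g : SimpleGraph V} [DecidableRel g.Adj] {a : L → ι} {q : ι → ℕ}

theorem two_mul_ncard_edgeSet_comap_inf_multiStar (ha : ∀ i, {x | a x = i}.ncard = q i)
    (e : ι ⊕ L ≃ V) :
    2 * (g.comap e ⊓ multiStar a).edgeSet.ncard =
      ∑ i, ∑ j, (if g.Adj (e (.inl i)) (e (.inl j)) then 1 else 0) +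
        2 * (∑ i, q i - #{x | ¬ g.Adj (e (.inl (a x))) (e (.inr x))}) := by
  classical
  rw [two_mul_ncard_edgeSet_inf_multiStar, ← card_filter_mem_eq_sum ha univ,
    filter_true_of_mem fun _ _ => mem_univ _,
    ← card_filter_add_card_filter_not (s := univ) fun x => g.Adj (e (.inl (a x))) (e (.inr x)),
    Nat.add_sub_cancel]
  rfl

variable [Fintype V] [DecidableEq V] [DecidableEq ι]

theorem sup_ncard_edgeSet_comap_inf_multiStar [DecidableEq L]
    (ha : ∀ i, {x | a x = i}.ncard = q i)
    (hcard : Fintype.card ι + Fintype.card L = Fintype.card V) :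
    univ.sup (fun e : ι ⊕ L ≃ V => 2 * (g.comap e ⊓ multiStar a).edgeSet.ncard) =
      maxStarOverlap g q := by
  refine le_antisymm (Finset.sup_le fun e _ => ?_) (Finset.sup_le fun c _ => ?_)
  · refine le_sup_of_le (mem_univ (e ∘ .inl)) ?_
    rw [if_pos (e.injective.comp Sum.inl_injective), starOverlap,
      two_mul_ncard_edgeSet_comap_inf_multiStar ha]
    have hdef := starDeficiency_le (g := g) ha e
    simp only [Function.comp_apply]
    gcongr
  · split_ifs with hc
    · obtain ⟨e, rfl, hdef⟩ := exists_equiv_card_le_starDeficiency (g := g) ha hcard hc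
      refine le_sup_of_le (mem_univ e) ?_
      rw [starOverlap, two_mul_ncard_edgeSet_comap_inf_multiStar ha]
      simp only [Function.comp_apply]
      gcongr
    · exact Nat.zero_le _

theorem isGraphEditDistance_multiStar (ha : ∀ i, {x | a x = i}.ncard = q i)
    (hcard : Fintype.card ι + Fintype.card L = Fintype.card V) :
    IsGraphEditDistance g (multiStar a)
      ((∑ u, ∑ v, (if g.Adj u v then 1 else 0) +
        (Fintype.card ι * (Fintype.card ι - 1) + 2 * Fintype.card L) -
          2 * maxStarOverlap g q) / 2) := by
  classical
  have hne : Nonempty (ι ⊕ L ≃ V) := by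
    rw [← Fintype.card_eq, Fintype.card_sum, hcard]
  have hdist (e : ι ⊕ L ≃ V) := ncard_edgeSet_symmDiff_add (g.comap e) (multiStar a)
  have hiso (e : ι ⊕ L ≃ V) : (g.comap e).edgeSet.ncard = g.edgeSet.ncard :=
    Nat.card_congr (SimpleGraph.Iso.comap e g).mapEdgeSet
  rw [sum_sum_ite_adj, ← two_mul_ncard_edgeSet_multiStar a,
    ← sup_ncard_edgeSet_comap_inf_multiStar ha hcard]
  let f (e : ι ⊕ L ≃ V) : ℕ := 2 * (g.comap e ⊓ multiStar a).edgeSet.ncard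
  obtain ⟨e, -, he⟩ := exists_mem_eq_sup univ univ_nonempty f
  refine isGraphEditDistance_of_isLeast ⟨⟨e, ?_⟩, ?_⟩
  · have := hdist e
    simp only [hiso, he, f] at this ⊢
    omega
  · rintro _ ⟨e', rfl⟩
    have hmax : f e' ≤ univ.sup f := le_sup (mem_univ e')
    have := hdist e'
    simp only [hiso, f] at this hmax ⊢
    omega

theorem IsKStar.isGraphEditDistance {k : ℕ} {h : SimpleGraph V} (hh : IsKStar k h) :
    IsGraphEditDistance g h
      ((∑ u, ∑ v, (if g.Adj u v then 1 else 0) +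
        (k * (k - 1) + 2 * (Fintype.card V - k)) -
          2 * maxStarOverlap g fun j : Fin k => evenShare (Fintype.card V - k) k j) / 2) := by
  obtain ⟨S, a, ha, ⟨φ⟩⟩ := hh.exists_multiStar_iso
  have hcard := Fintype.card_congr φ.toEquiv
  rw [Fintype.card_sum] at hcard
  have hL : Fintype.card {u // u ∉ S} = Fintype.card V - k := by
    rw [← hcard, Fintype.card_fin, Nat.add_sub_cancel_left]
  simpa only [hL, Fintype.card_fin] using (isGraphEditDistance_multiStar ha hcard).congr_right φ

end EditDistance

namespace RAM

/-! ### Runs of programs -/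

/-- `Steps P B t s f`: the program `P` runs from `s` to `f` in exactly `t` steps, and no number
larger than `B` is stored in any configuration before `f`. -/
inductive Steps (P : Program) (B : ℕ) : ℕ → Config → Config → Prop
  | refl (s : Config) : Steps P B 0 s s
  | step {t : ℕ} {s f : Config} {i : Instr} : P[s.pc]? = some i → s.Bounded B →
      Steps P B t (i.exec s) f → Steps P B (t + 1) s f

theorem getElem?_of_prefix {α : Type*} {l l' : List α} (h : l <+: l') {i : ℕ} {v : α}
    (hi : l[i]? = some v) : l'[i]? = some v := by
  obtain ⟨hlt, rfl⟩ := List.getElem?_eq_some_iff.1 hi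
  exact List.prefix_iff_getElem?.1 h i hlt

theorem Steps.trans {P : Program} {B t t' : ℕ} {s s' s'' : Config} (h : Steps P B t s s')
    (h' : Steps P B t' s' s'') : Steps P B (t + t') s s'' := by
  induction h with
  | refl s => rwa [Nat.zero_add]
  | step hi hb _ ih =>
    rw [Nat.add_right_comm]
    exact .step hi hb (ih h')

theorem Steps.haltsIn {P : Program} {B t : ℕ} {s f : Config} (h : Steps P B t s f)
    (hf : P[f.pc]? = none) (hb : f.Bounded B) : HaltsIn P B t s f := by
  induction h with
  | refl s => exact .halt hf hb
  | step hi hb' _ ih => exact .step hi hb' (ih hf hb)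

/-- What is known about a configuration between two instructions: it is at line `p`, its memory is
`M`, its registers start with `env`, and it is bounded by `B`. -/
structure State (M : ℕ → ℕ) (B : ℕ) (s : Config) (p : ℕ) (env : List ℕ) : Prop where
  pc : s.pc = p
  mem : s.mem = M
  bounded : s.Bounded B
  reg : ∀ i v, env[i]? = some v → s.reg i = v

/-- From line `p` with registers `env`, the program `P` reaches line `p'` with registers `env'`
within `T` steps, without storing a number larger than `B` or changing the memory `M`. -/
def Triple (M : ℕ → ℕ) (B : ℕ) (P : Program) (p : ℕ) (env : List ℕ) (T p' : ℕ)
    (env' : List ℕ) : Prop :=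
  ∀ s, State M B s p env → ∃ t ≤ T, ∃ s', Steps P B t s s' ∧ State M B s' p' env'

/-- The three-register instruction `i` applies the operation `f`. -/
def Realizes (i : ℕ → ℕ → ℕ → Instr) (f : ℕ → ℕ → ℕ) : Prop :=
  ∀ s a b c, (i a b c).exec s = s.setReg a (f (s.reg b) (s.reg c))

section Triple

variable {M : ℕ → ℕ} {B : ℕ} {P : Program} {s : Config} {p p' p'' T T' : ℕ}
  {env env' env'' : List ℕ}

theorem State.reg_le {a v : ℕ} (hs : State M B s p env) (ha : env[a]? = some v) : v ≤ B :=
  hs.reg a v ha ▸ hs.bounded.1 a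

theorem Config.setReg_reg_self (s : Config) (a v : ℕ) : (s.setReg a v).reg a = v :=
  Function.update_self ..

theorem Config.setReg_reg_of_ne (s : Config) {a i : ℕ} (h : i ≠ a) (v : ℕ) :
    (s.setReg a v).reg i = s.reg i :=
  Function.update_of_ne h ..

theorem State.bounded_setReg {a v : ℕ} (hs : State M B s p env) (hv : v ≤ B) :
    (s.setReg a v).Bounded B := by
  refine ⟨fun i => ?_, hs.bounded.2⟩
  rcases eq_or_ne i a with rfl | hi
  · rwa [s.setReg_reg_self]
  · exact (s.setReg_reg_of_ne hi v).trans_le (hs.bounded.1 i)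

theorem State.set {v : ℕ} (hs : State M B s p env) (a : ℕ) (hv : v ≤ B) :
    State M B (s.setReg a v) (p + 1) (env.set a v) := by
  refine ⟨congrArg (· + 1) hs.pc, hs.mem, hs.bounded_setReg hv, fun i w hi => ?_⟩
  rcases eq_or_ne i a with rfl | hia
  · have hlt : i < env.length := by
      simpa only [List.length_set] using (List.getElem?_eq_some_iff.1 hi).1
    rw [List.getElem?_set_self hlt] at hi
    rw [s.setReg_reg_self, Option.some.inj hi]
  · rw [List.getElem?_set_ne hia.symm] at hi
    rw [s.setReg_reg_of_ne hia, hs.reg i w hi]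

theorem State.push {v : ℕ} (hs : State M B s p env) (hv : v ≤ B) :
    State M B (s.setReg env.length v) (p + 1) (env ++ [v]) := by
  refine ⟨congrArg (· + 1) hs.pc, hs.mem, hs.bounded_setReg hv, fun i w hi => ?_⟩
  rcases lt_trichotomy i env.length with hlt | rfl | hlt
  · rw [List.getElem?_append_left hlt] at hi
    rw [s.setReg_reg_of_ne hlt.ne, hs.reg i w hi]
  · rw [List.getElem?_concat_length] at hi
    rw [s.setReg_reg_self, Option.some.inj hi]
  · rw [List.getElem?_eq_none (by simpa using hlt)] at hi
    cases hi

theorem Triple.trans (h : Triple M B P p env T p' env') (h' : Triple M B P p' env' T' p'' env'') :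
    Triple M B P p env (T + T') p'' env'' := by
  intro s hs
  obtain ⟨t, ht, s', hsteps, hs'⟩ := h s hs
  obtain ⟨t', ht', s'', hsteps', hs''⟩ := h' s' hs'
  exact ⟨t + t', Nat.add_le_add ht ht', s'', hsteps.trans hsteps', hs''⟩

theorem Triple.mono (h : Triple M B P p env T p' env') (hT : T ≤ T') :
    Triple M B P p env T' p' env' := by
  intro s hs
  obtain ⟨t, ht, r⟩ := h s hs
  exact ⟨t, ht.trans hT, r⟩

theorem Triple.forget (h : Triple M B P p env T p' env') (hpre : env'' <+: env') :
    Triple M B P p env T p' env'' := by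
  intro s hs
  obtain ⟨t, ht, s', hsteps, hs'⟩ := h s hs
  exact ⟨t, ht, s', hsteps, hs'.pc, hs'.mem, hs'.bounded,
    fun i v hi => hs'.reg i v (getElem?_of_prefix hpre hi)⟩

theorem Triple.of_le {a v : ℕ} (ha : env[a]? = some v)
    (h : v ≤ B → Triple M B P p env T p' env') : Triple M B P p env T p' env' :=
  fun s hs => h (hs.reg_le ha) s hs

theorem Triple.of_exec {i : Instr} (hp : P[p]? = some i)
    (h : ∀ s, State M B s p env → State M B (i.exec s) p' env') :
    Triple M B P p env 1 p' env' :=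
  fun s hs => ⟨1, le_rfl, i.exec s, .step (hs.pc ▸ hp) hs.bounded (.refl _), h s hs⟩

theorem Triple.const_push {n : ℕ} (hp : P[p]? = some (.const env.length n)) (hn : n ≤ B) :
    Triple M B P p env 1 (p + 1) (env ++ [n]) :=
  .of_exec hp fun _ hs => hs.push hn

theorem Triple.const_set {a n : ℕ} (hp : P[p]? = some (.const a n)) (hn : n ≤ B) :
    Triple M B P p env 1 (p + 1) (env.set a n) :=
  .of_exec hp fun _ hs => hs.set a hn

theorem Triple.binary_set {i : ℕ → ℕ → ℕ → Instr} {f : ℕ → ℕ → ℕ} (hi : Realizes i f)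
    {a b c v w : ℕ} (hp : P[p]? = some (i a b c)) (hb : env[b]? = some v) (hc : env[c]? = some w)
    (hf : v ≤ B → w ≤ B → f v w ≤ B) :
    Triple M B P p env 1 (p + 1) (env.set a (f v w)) := by
  refine .of_exec hp fun s hs => ?_
  rw [hi, hs.reg b v hb, hs.reg c w hc]
  exact hs.set a (hf (hs.reg_le hb) (hs.reg_le hc))

theorem Triple.load_set {a b v : ℕ} (hp : P[p]? = some (.load a b)) (hb : env[b]? = some v) :
    Triple M B P p env 1 (p + 1) (env.set a (M v)) := by
  refine .of_exec hp fun s hs => ?_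
  rw [Instr.exec, hs.mem, hs.reg b v hb]
  exact hs.set a (hs.mem ▸ hs.bounded.2 v)

theorem Triple.jmp {l : ℕ} (hp : P[p]? = some (.jmp l)) : Triple M B P p env 1 l env :=
  .of_exec hp fun _ hs => ⟨rfl, hs.mem, hs.bounded, hs.reg⟩

theorem Triple.jz_zero {a l : ℕ} (hp : P[p]? = some (.jz a l)) (ha : env[a]? = some 0) :
    Triple M B P p env 1 l env :=
  .of_exec hp fun _ hs => ⟨if_pos (hs.reg a 0 ha), hs.mem, hs.bounded, hs.reg⟩

theorem Triple.jz_succ {a l n : ℕ} (hp : P[p]? = some (.jz a l)) (ha : env[a]? = some (n + 1)) :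
    Triple M B P p env 1 (p + 1) env := by
  refine .of_exec hp fun s hs => ⟨?_, hs.mem, hs.bounded, hs.reg⟩
  rw [Instr.exec, hs.reg a _ ha, if_neg n.succ_ne_zero, hs.pc]

end Triple

/-- The list `l` is the part of the program `P` that starts on line `p`. -/
def CodeAt (P : Program) (p : ℕ) (l : Program) : Prop :=
  ∃ l₁ l₂, P = l₁ ++ l ++ l₂ ∧ l₁.length = p

theorem CodeAt.left {P l l' : Program} {p : ℕ} (h : CodeAt P p (l ++ l')) : CodeAt P p l := by
  obtain ⟨l₁, l₂, rfl, hp⟩ := h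
  exact ⟨l₁, l' ++ l₂, by simp, hp⟩

theorem CodeAt.right {P l l' : Program} {p : ℕ} (h : CodeAt P p (l ++ l')) :
    CodeAt P (p + l.length) l' := by
  obtain ⟨l₁, l₂, rfl, rfl⟩ := h
  exact ⟨l₁ ++ l, l₂, by simp, by simp⟩

theorem CodeAt.tail {P l : Program} {p : ℕ} {i : Instr} (h : CodeAt P p (i :: l)) :
    CodeAt P (p + 1) l :=
  CodeAt.right (l := [i]) h

theorem CodeAt.head {P l : Program} {p : ℕ} {i : Instr} (h : CodeAt P p (i :: l)) :
    P[p]? = some i := by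
  obtain ⟨l₁, l₂, rfl, rfl⟩ := h
  simp

/-! ### Compiling expressions -/

/-- An expression, compiled to the instructions that compute it into register `d` when placed on
line `p`: all lower registers are kept, and higher registers serve as scratch space. -/
abbrev Code := ℕ → ℕ → Program

/-- In every extension of the register contents `env`, the code `c` computes `v` into the next
register within `T` steps, without storing a number larger than `B` or changing the memory `M`. -/
def Computes (M : ℕ → ℕ) (B : ℕ) (env : List ℕ) (c : Code) (v T : ℕ) : Prop :=
  ∀ env', env <+: env' → ∀ P p, CodeAt P p (c env'.length p) →
    Triple M B P p env' T (p + (c env'.length p).length) (env' ++ [v])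

namespace Code

/-- Code for the literal `n`. -/
def lit (n : ℕ) : Code := fun d _ => [.const d n]

/-- Code for the content of register `x`. -/
def var (x : ℕ) : Code := fun d _ => [.const d 0, .add d d x]

/-- Code that applies the three-register instruction `i` to the values of `a` and `b`. -/
def binary (i : ℕ → ℕ → ℕ → Instr) (a b : Code) : Code := fun d p =>
  a d p ++ (b (d + 1) (p + (a d p).length) ++ [i d d (d + 1)])

/-- Code for `a + b`. -/
def add : Code → Code → Code := binary .add

/-- Code for the truncated difference `a - b`. -/
def sub : Code → Code → Code := binary .sub

/-- Code for `a * b`. -/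
def mul : Code → Code → Code := binary .mul

/-- Code for the rounded quotient `a / b`. -/
def div : Code → Code → Code := binary .div

/-- Code for the content of the memory cell with address `a`. -/
def load (a : Code) : Code := fun d p => a d p ++ [.load d d]

/-- The end of a round of a loop: the accumulator in register `d + 1` becomes the new value in
register `d + 3`, the index in register `d + 2` is increased, the number of remaining rounds in
register `d` is decreased, and the machine returns to line `p`. -/
def foldNext (d p : ℕ) : Program :=
  [.const (d + 1) 0, .add (d + 1) (d + 1) (d + 3), .const (d + 3) 1, .add (d + 2) (d + 2) (d + 3),
    .sub d d (d + 3), .jmp p]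

/-- The loop that applies `body` to the accumulator in register `d + 1` and the index in register
`d + 2` while register `d` is not `0`, and then moves the accumulator to register `d`. -/
def foldLoop (body : Code → Code → Code) : Code := fun d p =>
  let b := body (var (d + 1)) (var (d + 2)) (d + 3) (p + 1)
  .jz d (p + 1 + b.length + 6) :: (b ++ (foldNext d p ++ [.add d d (d + 1)]))

/-- Code that iterates `acc ↦ body acc i` over the indices `i < n`, starting from `start`. -/
def fold (n start : Code) (body : Code → Code → Code) : Code := fun d p =>
  let a := n d p
  let b := start (d + 1) (p + a.length)
  a ++ (b ++ (.const (d + 2) 0 :: foldLoop body d (p + a.length + b.length + 1)))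

end Code

namespace Computes

variable {M : ℕ → ℕ} {B : ℕ} {env : List ℕ}

theorem extend {env' : List ℕ} {c : Code} {v T : ℕ} (h : Computes M B env c v T)
    (he : env <+: env') : Computes M B env' c v T :=
  fun env'' he' => h env'' (he.trans he')

theorem mono {c : Code} {v T T' : ℕ} (h : Computes M B env c v T) (hT : T ≤ T') :
    Computes M B env c v T' :=
  fun env' he P p hc => (h env' he P p hc).mono hT

theorem lit {n : ℕ} (hn : n ≤ B) : Computes M B env (Code.lit n) n 1 :=
  fun _ _ _ _ hc => .const_push hc.head hn

theorem var {x v : ℕ} (hx : env[x]? = some v) : Computes M B env (Code.var x) v 2 := by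
  intro env' he P p hc
  have hzero := Triple.const_push (M := M) (env := env') hc.head (Nat.zero_le B)
  have hadd := Triple.binary_set (M := M) (B := B) (f := (· + ·)) (fun _ _ _ _ => rfl) hc.tail.head
    (List.getElem?_concat_length (l := env') (a := 0))
    (getElem?_of_prefix (he.trans (List.prefix_append ..)) hx) fun _ hv => by simpa using hv
  simpa [Code.var] using hzero.trans hadd

theorem binary {i : ℕ → ℕ → ℕ → Instr} {f : ℕ → ℕ → ℕ} (hi : Realizes i f) {a b : Code}
    {va vb Ta Tb : ℕ} (ha : Computes M B env a va Ta) (hb : Computes M B env b vb Tb)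
    (hf : va ≤ B → vb ≤ B → f va vb ≤ B) :
    Computes M B env (Code.binary i a b) (f va vb) (Ta + Tb + 1) := by
  intro env' he P p hc
  have hleft := ha env' he P p hc.left
  have hright := hb (env' ++ [va]) (he.trans (List.prefix_append ..)) P _
    (by simpa using hc.right.left)
  have hop := Triple.binary_set (M := M) (B := B) (env := env' ++ [va] ++ [vb]) hi
    hc.right.right.head (by simp) (by simp) hf
  have hforget := hop.forget (env'' := env' ++ [f va vb]) (by simp)
  simp only [List.append_assoc, List.length_append, List.length_singleton] at hright hforget
  simpa [Code.binary, Nat.add_assoc] using hleft.trans (hright.trans hforget)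

theorem add {a b : Code} {va vb Ta Tb : ℕ} (ha : Computes M B env a va Ta)
    (hb : Computes M B env b vb Tb) (hv : va ≤ B → vb ≤ B → va + vb ≤ B) :
    Computes M B env (Code.add a b) (va + vb) (Ta + Tb + 1) :=
  binary (f := (· + ·)) (fun _ _ _ _ => rfl) ha hb hv

theorem sub {a b : Code} {va vb Ta Tb : ℕ} (ha : Computes M B env a va Ta)
    (hb : Computes M B env b vb Tb) :
    Computes M B env (Code.sub a b) (va - vb) (Ta + Tb + 1) :=
  binary (f := (· - ·)) (fun _ _ _ _ => rfl) ha hb fun h _ => (Nat.sub_le ..).trans h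

theorem mul {a b : Code} {va vb Ta Tb : ℕ} (ha : Computes M B env a va Ta)
    (hb : Computes M B env b vb Tb) (hv : va ≤ B → vb ≤ B → va * vb ≤ B) :
    Computes M B env (Code.mul a b) (va * vb) (Ta + Tb + 1) :=
  binary (f := (· * ·)) (fun _ _ _ _ => rfl) ha hb hv

theorem div {a b : Code} {va vb Ta Tb : ℕ} (ha : Computes M B env a va Ta)
    (hb : Computes M B env b vb Tb) :
    Computes M B env (Code.div a b) (va / vb) (Ta + Tb + 1) :=
  binary (f := (· / ·)) (fun _ _ _ _ => rfl) ha hb fun h _ => (Nat.div_le_self ..).trans h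

theorem load {a : Code} {va Ta : ℕ} (ha : Computes M B env a va Ta) :
    Computes M B env (Code.load a) (M va) (Ta + 1) := by
  intro env' he P p hc
  have hload := Triple.load_set (M := M) (B := B) (env := env' ++ [va]) hc.right.head
    List.getElem?_concat_length
  simpa [Code.load, Nat.add_assoc] using (ha env' he P p hc.left).trans hload

end Computes

section Fold

variable {M : ℕ → ℕ} {B : ℕ} {env : List ℕ} {P : Program} {p q : ℕ}

theorem Triple.foldNext {m v w i : ℕ} (hc : CodeAt P q (Code.foldNext env.length p))
    (hi : i + 1 ≤ B) :
    Triple M B P q (env ++ [m + 1, v, i, w]) 6 p (env ++ [m, w, i + 1]) := by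
  have hB : 1 ≤ B := (Nat.le_add_left 1 i).trans hi
  have hclear := Triple.const_set (M := M) (env := env ++ [m + 1, v, i, w]) hc.head (Nat.zero_le B)
  have hmove := Triple.binary_set (M := M) (B := B) (env := env ++ [m + 1, 0, i, w])
    (f := (· + ·)) (v := 0) (w := w) (fun _ _ _ _ => rfl) hc.tail.head (by simp) (by simp)
    fun _ hw => by simpa using hw
  have hone := Triple.const_set (M := M) (env := env ++ [m + 1, w, i, w]) hc.tail.tail.head hB
  have hindex := Triple.binary_set (M := M) (B := B) (env := env ++ [m + 1, w, i, 1])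
    (f := (· + ·)) (v := i) (w := 1) (fun _ _ _ _ => rfl) hc.tail.tail.tail.head (by simp) (by simp)
    fun _ _ => hi
  have hcount := Triple.binary_set (M := M) (B := B) (env := env ++ [m + 1, w, i + 1, 1])
    (f := (· - ·)) (v := m + 1) (w := 1) (fun _ _ _ _ => rfl) hc.tail.tail.tail.tail.head (by simp)
    (by simp) fun hm _ => (Nat.sub_le ..).trans hm
  have hjmp := Triple.jmp (M := M) (B := B) (env := env ++ [m, w, i + 1, 1])
    hc.tail.tail.tail.tail.tail.head
  have hforget := hjmp.forget (env'' := env ++ [m, w, i + 1]) (by simp)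
  simp only [le_add_iff_nonneg_right, zero_le, List.set_append_right, add_tsub_cancel_left,
    List.set_cons_succ, List.set_cons_zero, zero_add, add_tsub_cancel_right, le_refl,
    tsub_self] at hclear hmove hone hindex hcount
  exact hclear.trans (hmove.trans (hone.trans (hindex.trans (hcount.trans hforget))))

theorem Triple.foldLoop_zero {body : Code → Code → Code} {v i : ℕ}
    (hc : CodeAt P p (Code.foldLoop body env.length p)) :
    Triple M B P p (env ++ [0, v, i]) 2 (p + (Code.foldLoop body env.length p).length)
      (env ++ [v]) := by
  have hexit := Triple.jz_zero (M := M) (B := B) (env := env ++ [0, v, i]) hc.head (by simp)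
  have hmove := Triple.binary_set (M := M) (B := B) (env := env ++ [0, v, i]) (f := (· + ·))
    (v := 0) (w := v) (fun _ _ _ _ => rfl) hc.tail.right.right.head (by simp) (by simp)
    fun _ hv => by simpa using hv
  have hforget := hmove.forget (env'' := env ++ [v]) (by simp)
  convert hexit.trans hforget using 1
  simp only [Code.foldLoop, Code.foldNext, List.length_append, List.length_cons, List.length_nil]
  omega

theorem Triple.foldLoop_succ {body : Code → Code → Code} {m v w i Tb : ℕ}
    (hc : CodeAt P p (Code.foldLoop body env.length p)) (hi : i + 1 ≤ B)
    (hb : Computes M B (env ++ [m + 1, v, i])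
      (body (Code.var (env.length + 1)) (Code.var (env.length + 2))) w Tb) :
    Triple M B P p (env ++ [m + 1, v, i]) (Tb + 7) p (env ++ [m, w, i + 1]) := by
  have henter := Triple.jz_succ (M := M) (B := B) (env := env ++ [m + 1, v, i]) (n := m) hc.head
    (by simp)
  have hbody := hb _ (List.prefix_refl _) P (p + 1) (by simpa using hc.tail.left)
  simp only [List.length_append, List.length_cons, List.length_nil, List.append_assoc,
    List.cons_append, List.nil_append] at hbody
  exact (henter.trans (hbody.trans (Triple.foldNext hc.tail.right.left hi))).mono (by omega)

theorem Triple.foldLoop {body : Code → Code → Code} {A : ℕ → ℕ} {n Tb : ℕ}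
    (hc : CodeAt P p (Code.foldLoop body env.length p)) (hn : n ≤ B)
    (hb : ∀ i < n, Computes M B (env ++ [n - i, A i, i])
      (body (Code.var (env.length + 1)) (Code.var (env.length + 2))) (A (i + 1)) Tb)
    {m i : ℕ} (him : i + m = n) :
    Triple M B P p (env ++ [m, A i, i]) (m * (Tb + 7) + 2)
      (p + (Code.foldLoop body env.length p).length) (env ++ [A n]) := by
  induction m generalizing i with
  | zero =>
    obtain rfl : i = n := him
    simpa using Triple.foldLoop_zero hc
  | succ m ih =>
    have hround : Triple M B P p (env ++ [m + 1, A i, i]) (Tb + 7) p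
        (env ++ [m, A (i + 1), i + 1]) := by
      refine Triple.foldLoop_succ hc (by omega) ?_
      rw [show m + 1 = n - i by omega]
      exact hb i (by omega)
    refine (hround.trans (ih (by omega))).mono (le_of_eq ?_)
    ring

theorem Computes.fold {n start : Code} {body : Code → Code → Code} {vn Tn Ti Tb : ℕ} (A : ℕ → ℕ)
    (hn : Computes M B env n vn Tn) (hi : Computes M B env start (A 0) Ti)
    (hb : ∀ env' acc idx, env <+: env' → ∀ i < vn, Computes M B env' acc (A i) 2 →
      Computes M B env' idx i 2 → Computes M B env' (body acc idx) (A (i + 1)) Tb) :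
    Computes M B env (Code.fold n start body) (A vn) (Tn + Ti + 3 + vn * (Tb + 7)) := by
  intro env' he P p hc
  have hcount := hn env' he P p hc.left
  have hstart := hi (env' ++ [vn]) (he.trans (List.prefix_append ..)) P _
    (by simpa using hc.right.left)
  have hzero := Triple.const_push (M := M) (env := env' ++ [vn] ++ [A 0])
    (by simpa using hc.right.right.head) (Nat.zero_le B)
  have hloop : Triple M B P _ (env' ++ [vn, A 0, 0]) _ _ (env' ++ [A vn]) :=
    .of_le (a := env'.length) (v := vn) (by simp) fun hvn =>
      Triple.foldLoop (Tb := Tb) (by simpa using hc.right.right.tail) hvn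
        (fun i hi => hb _ _ _ (he.trans (List.prefix_append ..)) i hi (.var (by simp))
          (.var (by simp))) (Nat.zero_add vn)
  simp only [List.append_assoc, List.length_append, List.length_singleton, List.cons_append,
    List.nil_append] at hstart hzero
  convert hcount.trans (hstart.trans (hzero.trans hloop)) using 1
  · omega
  · simp only [Code.fold, List.length_append, List.length_cons]
    omega

end Fold

/-! ### Derived expressions -/

open Finset

namespace Code

/-- Code for the sum of `f i` over `i < n`. -/
def sum (n : Code) (f : Code → Code) : Code := fold n (lit 0) fun acc i => add acc (f i)

/-- Code for the maximum of `0` and the values `f i` for `i < n`. -/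
def sup (n : Code) (f : Code → Code) : Code := fold n (lit 0) fun acc i => add (sub acc (f i)) (f i)

/-- Code for the universal quantification over `i < n` of a truth value `f i`, which is coded as `1`
or `0`. -/
def all (n : Code) (f : Code → Code) : Code := fold n (lit 1) fun acc i => mul acc (f i)

/-- Code for the negation of a truth value. -/
def not (a : Code) : Code := sub (lit 1) a

/-- Code for the implication between truth values. -/
def imp (a b : Code) : Code := not (mul a (not b))

/-- Code for the truth value of `a = b`. -/
def eq (a b : Code) : Code := not (add (sub a b) (sub b a))

/-- Code for the truth value of `a < b`. -/
def lt (a b : Code) : Code := not (not (sub b a))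

/-- Code for the power `b ^ n`. -/
def pow (b n : Code) : Code := fold n (lit 1) fun acc _ => mul acc b

/-- Code for the remainder of `a` modulo `b`. -/
def mod (a b : Code) : Code := sub a (mul (div a b) b)

/-- Code for the digit of `x` in base `b` at the place of `b ^ i`. -/
def digit (b x i : Code) : Code := mod (div x (pow b i)) b

end Code

namespace Computes

variable {M : ℕ → ℕ} {B : ℕ} {env : List ℕ}

theorem fold_univ {n start : Code} {body : Code → Code → Code} {m Tn Ti Tb : ℕ}
    (A : Finset (Fin m) → ℕ) (hn : Computes M B env n m Tn) (hi : Computes M B env start (A ∅) Ti)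
    (hb : ∀ env' acc idx, env <+: env' → ∀ (s : Finset (Fin m)) (i : Fin m), i ∉ s →
      Computes M B env' acc (A s) 2 → Computes M B env' idx i 2 →
      Computes M B env' (body acc idx) (A (insert i s)) Tb) :
    Computes M B env (Code.fold n start body) (A univ) (Tn + Ti + 3 + m * (Tb + 7)) := by
  have hfold := fold (fun i => A {j | (j : ℕ) < i}) hn (by simpa using hi) (Tb := Tb)
    fun env' acc idx he i hi hacc hidx => by
      rw [show univ.filter (fun j : Fin m => (j : ℕ) < i + 1) =
          insert ⟨i, hi⟩ (univ.filter fun j : Fin m => (j : ℕ) < i) by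
        ext j
        simp [Fin.ext_iff, Nat.le_iff_lt_or_eq, or_comm]]
      exact hb env' acc idx he _ ⟨i, hi⟩ (by simp) hacc hidx
  simpa using hfold

theorem sum {n : Code} {f : Code → Code} {m Tn Tf : ℕ} {F : Fin m → ℕ}
    (hn : Computes M B env n m Tn)
    (hf : ∀ env' idx, env <+: env' → ∀ i : Fin m, Computes M B env' idx i 2 →
      Computes M B env' (f idx) (F i) Tf) (hF : ∑ i, F i ≤ B) :
    Computes M B env (Code.sum n f) (∑ i, F i) (Tn + 4 + m * (Tf + 10)) := by
  refine (fold_univ (fun s => ∑ i ∈ s, F i) (Tb := Tf + 3) hn (lit (Nat.zero_le _))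
    fun env' acc idx he s i hs hacc hidx => ?_).mono (le_of_eq (by ring))
  rw [sum_insert hs, Nat.add_comm (F i)]
  refine (add hacc (hf env' idx he i hidx) fun _ _ => ?_).mono (by omega)
  rw [Nat.add_comm, ← sum_insert hs]
  exact (sum_le_sum_of_subset (subset_univ _)).trans hF

theorem sup {n : Code} {f : Code → Code} {m Tn Tf : ℕ} {F : Fin m → ℕ}
    (hn : Computes M B env n m Tn)
    (hf : ∀ env' idx, env <+: env' → ∀ i : Fin m, Computes M B env' idx i 2 →
      Computes M B env' (f idx) (F i) Tf) (hF : ∀ i, F i ≤ B) :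
    Computes M B env (Code.sup n f) (univ.sup F) (Tn + 4 + m * (2 * Tf + 11)) := by
  refine (fold_univ (fun s => s.sup F) (Tb := 2 * Tf + 4) hn (lit (Nat.zero_le _))
    fun env' acc idx he s i _ hacc hidx => ?_).mono (le_of_eq (by ring))
  have hs : s.sup F ≤ B := Finset.sup_le fun j _ => hF j
  have hi := hf env' idx he i hidx
  have hmax : s.sup F - F i + F i = (insert i s).sup F := by
    rw [sup_insert, sup_comm, Nat.sub_add_eq_max]
  rw [← hmax]
  refine (add (sub hacc hi) hi fun _ _ => ?_).mono (by omega)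
  rw [Nat.sub_add_eq_max]
  exact max_le hs (hF i)

theorem not {a : Code} {p : Prop} [Decidable p] {Ta : ℕ} (hB : 1 ≤ B)
    (ha : Computes M B env a (if p then 1 else 0) Ta) :
    Computes M B env (Code.not a) (if ¬ p then 1 else 0) (Ta + 2) := by
  rw [show (if ¬ p then 1 else 0) = 1 - if p then 1 else 0 by split_ifs <;> rfl]
  exact (sub (lit hB) ha).mono (by omega)

theorem and {a b : Code} {p q : Prop} [Decidable p] [Decidable q] {Ta Tb : ℕ} (hB : 1 ≤ B)
    (ha : Computes M B env a (if p then 1 else 0) Ta)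
    (hb : Computes M B env b (if q then 1 else 0) Tb) :
    Computes M B env (Code.mul a b) (if p ∧ q then 1 else 0) (Ta + Tb + 1) := by
  have hmul := mul ha hb fun _ _ => by split_ifs <;> omega
  rwa [ite_zero_mul_ite_zero] at hmul

theorem imp {a b : Code} {p q : Prop} [Decidable p] [Decidable q] {Ta Tb : ℕ} (hB : 1 ≤ B)
    (ha : Computes M B env a (if p then 1 else 0) Ta)
    (hb : Computes M B env b (if q then 1 else 0) Tb) :
    Computes M B env (Code.imp a b) (if p → q then 1 else 0) (Ta + Tb + 5) := by
  simp only [← not_and_not_right (a := p)]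
  exact (not hB (and hB ha (not hB hb))).mono (by omega)

theorem all {n : Code} {f : Code → Code} {m Tn Tf : ℕ} {p : Fin m → Prop} [DecidablePred p]
    [Decidable (∀ i, p i)] (hB : 1 ≤ B) (hn : Computes M B env n m Tn)
    (hf : ∀ env' idx, env <+: env' → ∀ i : Fin m, Computes M B env' idx i 2 →
      Computes M B env' (f idx) (if p i then 1 else 0) Tf) :
    Computes M B env (Code.all n f) (if ∀ i, p i then 1 else 0) (Tn + 4 + m * (Tf + 10)) := by
  have hfold := fold_univ (fun s => if ∀ i ∈ s, p i then 1 else 0)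
    (body := fun acc i => .mul acc (f i)) (Tb := Tf + 3) hn
    (by simpa using lit hB) fun env' acc idx he s i _ hacc hidx => by
      simpa [and_comm, Nat.add_comm 2 Tf] using and hB hacc (hf env' idx he i hidx)
  simp only [mem_univ, forall_const] at hfold
  exact hfold.mono (le_of_eq (by ring))

theorem eq {a b : Code} {va vb Ta Tb : ℕ} (hB : 1 ≤ B) (ha : Computes M B env a va Ta)
    (hb : Computes M B env b vb Tb) :
    Computes M B env (Code.eq a b) (if va = vb then 1 else 0) (2 * Ta + 2 * Tb + 5) := by
  rw [show (if va = vb then 1 else 0) = 1 - (va - vb + (vb - va)) by split_ifs <;> omega]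
  exact (sub (lit hB) (add (sub ha hb) (sub hb ha) fun _ _ => by omega)).mono (by omega)

theorem lt {a b : Code} {va vb Ta Tb : ℕ} (hB : 1 ≤ B) (ha : Computes M B env a va Ta)
    (hb : Computes M B env b vb Tb) :
    Computes M B env (Code.lt a b) (if va < vb then 1 else 0) (Ta + Tb + 5) := by
  rw [show (if va < vb then 1 else 0) = 1 - (1 - (vb - va)) by split_ifs <;> omega]
  exact (sub (lit hB) (sub (lit hB) (sub hb ha))).mono (by omega)

theorem pow {b n : Code} {vb vn Tb Tn : ℕ} (hvb : 1 ≤ vb) (hB : vb ^ vn ≤ B)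
    (hb : Computes M B env b vb Tb) (hn : Computes M B env n vn Tn) :
    Computes M B env (Code.pow b n) (vb ^ vn) (Tn + 4 + vn * (Tb + 10)) := by
  refine (fold (fun m => vb ^ m) (Tb := Tb + 3) hn (lit ((Nat.one_le_pow _ _ hvb).trans hB))
    fun env' acc _ he i hi hacc _ => ?_).mono (le_of_eq (by ring))
  exact (mul hacc (hb.extend he) fun _ _ => (Nat.pow_le_pow_right hvb hi).trans hB).mono
    (by omega)

theorem mod {a b : Code} {va vb Ta Tb : ℕ} (hva : va ≤ B) (ha : Computes M B env a va Ta)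
    (hb : Computes M B env b vb Tb) :
    Computes M B env (Code.mod a b) (va % vb) (2 * Ta + 2 * Tb + 3) := by
  rw [Nat.mod_eq_sub_div_mul]
  exact (sub ha (mul (div ha hb) hb fun _ _ => (Nat.div_mul_le_self ..).trans hva)).mono (by omega)

theorem digit {cb cx cj : Code} {b k : ℕ} {f : Fin k → Fin b} {j : Fin k} (hB : b ^ k ≤ B)
    (hb : Computes M B env cb b 2) (hx : Computes M B env cx (finFunctionFinEquiv f) 2)
    (hj : Computes M B env cj j 2) :
    Computes M B env (Code.digit cb cx cj) (f j) (25 + 24 * k) := by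
  have hpow : b ^ (j : ℕ) ≤ B := (Nat.pow_le_pow_right (f j).pos j.2.le).trans hB
  have hdiv := div hx (pow (f j).pos hpow hb hj)
  rw [← finFunctionFinEquiv.symm_apply_apply f, finFunctionFinEquiv_symm_apply_val]
  exact (mod ((Nat.div_le_self ..).trans ((finFunctionFinEquiv f).2.le.trans hB)) hdiv hb).mono
    (by omega)

end Computes

end RAM

/-! ### The algorithm -/

open Finset in
theorem sup_univ_comp_of_surjective {α β M : Type*} [Fintype α] [Fintype β] [SemilatticeSup M]
    [OrderBot M] {s : α → β} (hs : s.Surjective) (F : β → M) :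
    (univ.sup fun a => F (s a)) = univ.sup F := by
  classical
  rw [← image_univ_of_surjective hs, sup_image]
  rfl

namespace RAM

open Finset

namespace Code

/-- Code for the number `k` of centres. -/
def numCentres : Code := var 0

/-- Code for the number of nodes. -/
def numNodes : Code := var 1

/-- Code for the truth value of the adjacency of the nodes `u` and `v`. -/
def adj (u v : Code) : Code := load (add (mul u numNodes) v)

/-- Code for the centre `j` of the tuple of centres with number `x`. -/
def centre (x j : Code) : Code := digit numNodes x j

/-- Code for the membership of `j` in the set of centres with number `T`. -/
def mem (T j : Code) : Code := digit (lit 2) T j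

/-- Code for the truth value of `u` not being a centre. -/
def isLeaf (x u : Code) : Code := all numCentres fun j => not (eq (centre x j) u)

/-- Code for the truth value of all neighbouring centres of `u` being in `T`. -/
def isConfined (x T u : Code) : Code :=
  all numCentres fun j => imp (adj u (centre x j)) (mem T j)

/-- Code for the number of leaves attached to the centre `j` of a `k`-star. -/
def share (j : Code) : Code :=
  add (div (sub numNodes numCentres) numCentres) (lt j (mod (sub numNodes numCentres) numCentres))

/-- Code for the number of leaves whose neighbouring centres all lie in `T`, reduced by the number
of leaves that a `k`-star attaches to `T`. -/
def excess (x T : Code) : Code :=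
  sub (sum numNodes fun u => mul (isLeaf x u) (isConfined x T u))
    (sum numCentres fun j => mul (mem T j) (share j))

/-- Code for `starDeficiency`. -/
def deficiency (x : Code) : Code := sup (pow (lit 2) numCentres) (excess x)

/-- Code for the truth value of the tuple of centres being injective. -/
def isInjective (x : Code) : Code :=
  all numCentres fun i => all numCentres fun j => imp (eq (centre x i) (centre x j)) (eq i j)

/-- Code for `starOverlap`. -/
def overlap (x : Code) : Code :=
  add (sum numCentres fun i => sum numCentres fun j => adj (centre x i) (centre x j))
    (mul (lit 2) (sub (sub numNodes numCentres) (deficiency x)))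

/-- Code for `maxStarOverlap`. -/
def maxOverlap : Code :=
  sup (pow numNodes numCentres) fun x => mul (isInjective x) (overlap x)

/-- Code for the graph edit distance to a `k`-star, as given by `IsKStar.isGraphEditDistance`. -/
def starDistance : Code :=
  div (sub (add (sum numNodes fun u => sum numNodes fun v => adj u v)
    (add (mul numCentres (sub numCentres (lit 1))) (mul (lit 2) (sub numNodes numCentres))))
      (mul (lit 2) maxOverlap)) (lit 2)

end Code

/-- The first registers of `env` contain `k` and the number of nodes of the graph `g`, the memory
`M` contains the adjacency matrix of `g`, and `B` bounds the numbers that occur in the algorithm. -/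
structure Context (M : ℕ → ℕ) (B : ℕ) (env : List ℕ) (k : ℕ) {μ : ℕ} (g : SimpleGraph (Fin μ))
    [DecidableRel g.Adj] : Prop where
  k_pos : 1 ≤ k
  k_le : k ≤ μ
  mem_apply : ∀ u v : Fin μ, M (u * μ + v) = if g.Adj u v then 1 else 0
  six_mul_sq_le : 6 * μ ^ 2 ≤ B
  pow_le : μ ^ k ≤ B
  two_pow_le : 2 ^ k ≤ B
  prefix_env : [k, μ] <+: env

namespace Context

variable {M : ℕ → ℕ} {B : ℕ} {env : List ℕ} {k μ : ℕ} {g : SimpleGraph (Fin μ)}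
  [DecidableRel g.Adj] {c : Fin k → Fin μ} {f : Fin k → Fin 2}

theorem extend {env' : List ℕ} (h : Context M B env k g) (he : env <+: env') :
    Context M B env' k g :=
  { h with prefix_env := h.prefix_env.trans he }

theorem numCentres (h : Context M B env k g) : Computes M B env Code.numCentres k 2 :=
  .var (getElem?_of_prefix h.prefix_env rfl)

theorem numNodes (h : Context M B env k g) : Computes M B env Code.numNodes μ 2 :=
  .var (getElem?_of_prefix h.prefix_env rfl)

theorem μ_pos (h : Context M B env k g) : 1 ≤ μ := h.k_pos.trans h.k_le

theorem sq_le (h : Context M B env k g) : μ ^ 2 ≤ B :=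
  (Nat.le_mul_of_pos_left _ (by norm_num)).trans h.six_mul_sq_le

theorem μ_le (h : Context M B env k g) : μ ≤ B :=
  (Nat.le_self_pow two_ne_zero μ).trans h.sq_le

theorem two_le (h : Context M B env k g) : 2 ≤ B :=
  (Nat.le_self_pow (Nat.one_le_iff_ne_zero.1 h.k_pos) 2).trans h.two_pow_le

theorem one_le (h : Context M B env k g) : 1 ≤ B := one_le_two.trans h.two_le

theorem adj {cu cv : Code} {u v : Fin μ} {Tu Tv : ℕ} (h : Context M B env k g)
    (hu : Computes M B env cu u Tu) (hv : Computes M B env cv v Tv) :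
    Computes M B env (Code.adj cu cv) (if g.Adj u v then 1 else 0) (Tu + Tv + 5) := by
  have haddress : u * μ + v ≤ B := by
    refine le_trans ?_ h.sq_le
    nlinarith [u.2, v.2]
  rw [← h.mem_apply]
  refine (Computes.load (.add (.mul hu h.numNodes fun _ _ => ?_) hv fun _ _ => haddress)).mono
    (by omega)
  exact (Nat.le_add_right ..).trans haddress

theorem centre {cx cj : Code} {j : Fin k} (h : Context M B env k g)
    (hx : Computes M B env cx (finFunctionFinEquiv c) 2) (hj : Computes M B env cj j 2) :
    Computes M B env (Code.centre cx cj) (c j) (25 + 24 * k) :=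
  .digit h.pow_le h.numNodes hx hj

theorem mem {cT cj : Code} {j : Fin k} (h : Context M B env k g)
    (hT : Computes M B env cT (finFunctionFinEquiv f) 2) (hj : Computes M B env cj j 2) :
    Computes M B env (Code.mem cT cj) (if f j = 1 then 1 else 0) (25 + 24 * k) := by
  rw [show (if f j = 1 then 1 else 0) = (f j : ℕ) by
    generalize f j = b
    fin_cases b <;> rfl]
  exact .digit h.two_pow_le ((Computes.lit h.two_le).mono one_le_two) hT hj

theorem isLeaf {cx cu : Code} {u : Fin μ} (h : Context M B env k g)
    (hx : Computes M B env cx (finFunctionFinEquiv c) 2) (hu : Computes M B env cu u 2) :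
    Computes M B env (Code.isLeaf cx cu) (if u ∉ Set.range c then 1 else 0)
      (6 + k * (71 + 48 * k)) := by
  simp only [Set.mem_range, not_exists, Fin.ext_iff]
  refine (Computes.all (Tf := 61 + 48 * k) h.one_le h.numCentres
    fun env' idx he j hidx => ?_).mono (le_of_eq (by ring))
  exact (Computes.not h.one_le (.eq h.one_le ((h.extend he).centre (hx.extend he) hidx)
    (hu.extend he))).mono (by omega)

theorem isConfined {cx cT cu : Code} {u : Fin μ} (h : Context M B env k g)
    (hx : Computes M B env cx (finFunctionFinEquiv c) 2)
    (hT : Computes M B env cT (finFunctionFinEquiv f) 2) (hu : Computes M B env cu u 2) :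
    Computes M B env (Code.isConfined cx cT cu) (if ∀ j, g.Adj u (c j) → f j = 1 then 1 else 0)
      (6 + k * (72 + 48 * k)) := by
  refine (Computes.all (Tf := 62 + 48 * k) h.one_le h.numCentres
    fun env' idx he j hidx => ?_).mono (le_of_eq (by ring))
  have hcentre := (h.extend he).centre (hx.extend he) hidx
  exact (Computes.imp h.one_le ((h.extend he).adj (hu.extend he) hcentre)
    ((h.extend he).mem (hT.extend he) hidx)).mono (by omega)

theorem share {cj : Code} {j : Fin k} (h : Context M B env k g) (hj : Computes M B env cj j 2) :
    Computes M B env (Code.share cj) (evenShare (μ - k) k j) 33 := by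
  have hleaves := Computes.sub h.numNodes h.numCentres
  have hshare : evenShare (μ - k) k j ≤ B := calc
    evenShare (μ - k) k j ≤ ∑ j : Fin k, evenShare (μ - k) k j :=
      single_le_sum (f := fun j : Fin k => evenShare (μ - k) k j) (fun _ _ => Nat.zero_le _)
        (mem_univ j)
    _ = μ - k := sum_evenShare h.k_pos _
    _ ≤ B := (Nat.sub_le ..).trans h.μ_le
  exact (Computes.add (.div hleaves h.numCentres)
    (.lt h.one_le hj (.mod ((Nat.sub_le ..).trans h.μ_le) hleaves h.numCentres))
    fun _ _ => hshare).mono (by omega)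

theorem excess {cx cT : Code} (h : Context M B env k g)
    (hx : Computes M B env cx (finFunctionFinEquiv c) 2)
    (hT : Computes M B env cT (finFunctionFinEquiv f) 2) :
    Computes M B env (Code.excess cx cT)
      (#{u | u ∉ Set.range c ∧ ∀ j, g.Adj u (c j) → f j = 1} -
        ∑ j with f j = 1, evenShare (μ - k) k j)
      (13 + k * (69 + 24 * k) + μ * (23 + k * (143 + 96 * k))) := by
  have hshares : ∑ j : Fin k, (if f j = 1 then evenShare (μ - k) k j else 0) ≤ B := by
    rw [← sum_filter]
    refine (sum_le_sum_of_subset (subset_univ _)).trans ?_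
    rw [sum_evenShare h.k_pos]
    exact (Nat.sub_le ..).trans h.μ_le
  rw [card_filter, sum_filter]
  refine (Computes.sub
    (Computes.sum (Tf := 13 + k * (143 + 96 * k)) h.numNodes (fun env' idx he u hidx => ?_) ?_)
    (Computes.sum (Tf := 59 + 24 * k) h.numCentres (fun env' idx he j hidx => ?_) hshares)).mono
      (le_of_eq (by ring))
  · exact (Computes.and h.one_le ((h.extend he).isLeaf (hx.extend he) hidx)
      ((h.extend he).isConfined (hx.extend he) (hT.extend he) hidx)).mono (le_of_eq (by ring))
  · rw [← card_filter]
    exact (card_le_univ _).trans (by simpa using h.μ_le)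
  · rw [← boole_mul]
    refine (Computes.mul ((h.extend he).mem (hT.extend he) hidx) ((h.extend he).share hidx)
      fun _ hshare => ?_).mono (by omega)
    split_ifs <;> omega

/-- A bound for the running time on one tuple of centres, divided by the number of nodes. -/
def candidateTime (k : ℕ) : ℕ :=
  32 + 11 * k + k * (16 + k * (133 + 96 * k)) + k * (16 + k * (65 + 48 * k)) +
    2 ^ k * (37 + 2 * (k * (69 + 24 * k)) + 2 * (23 + k * (143 + 96 * k)))

theorem deficiency {cx : Code} (h : Context M B env k g)
    (hx : Computes M B env cx (finFunctionFinEquiv c) 2) :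
    Computes M B env (Code.deficiency cx) (starDeficiency g c fun j => evenShare (μ - k) k j)
      (10 + 11 * k +
        2 ^ k * (37 + 2 * (k * (69 + 24 * k)) + 2 * (μ * (23 + k * (143 + 96 * k))))) := by
  have hsurjective : Function.Surjective fun T : Fin (2 ^ k) =>
      ({j | finFunctionFinEquiv.symm T j = 1} : Finset (Fin k)) := fun T =>
    ⟨finFunctionFinEquiv fun j => if j ∈ T then 1 else 0, by ext; simp⟩
  have hpow := Computes.pow one_le_two h.two_pow_le (Computes.lit h.two_le) h.numCentres
  rw [starDeficiency, ← sup_univ_comp_of_surjective hsurjective]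
  refine (Computes.sup (Tf := 13 + k * (69 + 24 * k) + μ * (23 + k * (143 + 96 * k))) hpow
    (fun env' idx he T hidx => ?_) fun T => ?_).mono (le_of_eq (by ring))
  · rw [← finFunctionFinEquiv.apply_symm_apply T] at hidx
    simpa only [mem_filter_univ] using (h.extend he).excess (hx.extend he) hidx
  · exact (Nat.sub_le ..).trans ((card_le_univ _).trans (by simpa using h.μ_le))

theorem isInjective {cx : Code} (h : Context M B env k g)
    (hx : Computes M B env cx (finFunctionFinEquiv c) 2) :
    Computes M B env (Code.isInjective cx) (if c.Injective then 1 else 0)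
      (6 + k * (16 + k * (133 + 96 * k))) := by
  simp only [Function.Injective, Fin.ext_iff]
  refine (Computes.all (Tf := 6 + k * (133 + 96 * k)) h.one_le h.numCentres
    fun env₁ idx₁ he₁ i hi => ?_).mono (le_of_eq (by ring))
  refine (Computes.all (Tf := 123 + 96 * k) h.one_le (h.extend he₁).numCentres
    fun env₂ idx₂ he₂ j hj => ?_).mono (le_of_eq (by ring))
  have h₂ := (h.extend he₁).extend he₂
  have hx₂ := (hx.extend he₁).extend he₂
  exact (Computes.imp h.one_le
    (.eq h.one_le (h₂.centre hx₂ (hi.extend he₂)) (h₂.centre hx₂ hj))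
    (.eq h.one_le (hi.extend he₂) hj)).mono (by omega)

theorem starOverlap_le (h : Context M B env k g) (c : Fin k → Fin μ) :
    starOverlap g c (fun j => evenShare (μ - k) k j) ≤ 3 * μ ^ 2 := by
  have hadj := sum_sum_ite_adj_le g c
  rw [Fintype.card_fin] at hadj
  have hk := Nat.pow_le_pow_left h.k_le 2
  have hμ := Nat.le_self_pow two_ne_zero μ
  rw [starOverlap, sum_evenShare h.k_pos]
  omega

theorem overlap {cx : Code} (h : Context M B env k g)
    (hx : Computes M B env cx (finFunctionFinEquiv c) 2) :
    Computes M B env (Code.overlap cx) (starOverlap g c fun j => evenShare (μ - k) k j)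
      (25 + 11 * k + k * (16 + k * (65 + 48 * k)) +
        2 ^ k * (37 + 2 * (k * (69 + 24 * k)) + 2 * (μ * (23 + k * (143 + 96 * k))))) := by
  have hbound := (h.starOverlap_le c).trans
    ((Nat.mul_le_mul_right _ (by norm_num)).trans h.six_mul_sq_le)
  rw [starOverlap, sum_evenShare h.k_pos] at hbound ⊢
  have hadj : Computes M B env
      (Code.sum Code.numCentres fun i => Code.sum Code.numCentres fun j =>
        Code.adj (Code.centre cx i) (Code.centre cx j))
      (∑ i, ∑ j, (if g.Adj (c i) (c j) then 1 else 0)) (6 + k * (16 + k * (65 + 48 * k))) := by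
    have hsum := (Nat.le_add_right ..).trans hbound
    refine (Computes.sum (Tf := 6 + k * (65 + 48 * k)) h.numCentres
      (fun env₁ idx₁ he₁ i hi => ?_) hsum).mono (le_of_eq (by ring))
    refine (Computes.sum (Tf := 55 + 48 * k) (h.extend he₁).numCentres
      (fun env₂ idx₂ he₂ j hj => ?_) ?_).mono (le_of_eq (by ring))
    · have h₂ := (h.extend he₁).extend he₂
      have hx₂ := (hx.extend he₁).extend he₂
      exact (h₂.adj (h₂.centre hx₂ (hi.extend he₂)) (h₂.centre hx₂ hj)).mono (by omega)
    · exact (single_le_sum (f := fun i => ∑ j, (if g.Adj (c i) (c j) then 1 else 0))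
        (fun _ _ => Nat.zero_le _) (mem_univ i)).trans hsum
  exact (Computes.add hadj
    (.mul (.lit h.two_le) (.sub (.sub h.numNodes h.numCentres) (h.deficiency hx))
      fun _ _ => (Nat.le_add_left ..).trans hbound)
    fun _ _ => hbound).mono (by omega)

theorem candidate {cx : Code} (h : Context M B env k g)
    (hx : Computes M B env cx (finFunctionFinEquiv c) 2) :
    Computes M B env (.mul (Code.isInjective cx) (Code.overlap cx))
      (if c.Injective then starOverlap g c (fun j => evenShare (μ - k) k j) else 0)
      (μ * candidateTime k) := by
  have hmul := Computes.mul (h.isInjective hx) (h.overlap hx) fun _ hoverlap => by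
    split_ifs <;> omega
  rw [boole_mul] at hmul
  refine hmul.mono ?_
  have hμ := Nat.mul_le_mul_right
    (32 + 11 * k + k * (16 + k * (133 + 96 * k)) + k * (16 + k * (65 + 48 * k)) +
      2 ^ k * (37 + 2 * (k * (69 + 24 * k)))) h.μ_pos
  rw [candidateTime]
  linarith

theorem maxStarOverlap_le (h : Context M B env k g) :
    maxStarOverlap g (fun j : Fin k => evenShare (μ - k) k j) ≤ 3 * μ ^ 2 := by
  refine Finset.sup_le fun c _ => ?_
  split_ifs
  · exact h.starOverlap_le c
  · exact Nat.zero_le _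

theorem maxOverlap (h : Context M B env k g) :
    Computes M B env Code.maxOverlap (maxStarOverlap g fun j : Fin k => evenShare (μ - k) k j)
      (10 + 12 * k + μ ^ k * (2 * (μ * candidateTime k) + 11)) := by
  have hpow := Computes.pow h.μ_pos h.pow_le h.numNodes h.numCentres
  rw [maxStarOverlap, ← sup_univ_comp_of_surjective finFunctionFinEquiv.symm.surjective]
  refine (Computes.sup (Tf := μ * candidateTime k) hpow (fun env' idx he x hidx => ?_)
    fun x => ?_).mono (le_of_eq (by ring))
  · rw [← finFunctionFinEquiv.apply_symm_apply x] at hidx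
    exact (h.extend he).candidate hidx
  · split_ifs
    · exact (h.starOverlap_le _).trans
        ((Nat.mul_le_mul_right _ (by norm_num)).trans h.six_mul_sq_le)
    · exact Nat.zero_le _

theorem sum_adj_le : ∑ u, ∑ v, (if g.Adj u v then 1 else 0) ≤ μ ^ 2 := by
  simpa only [Fintype.card_fin, id_eq] using sum_sum_ite_adj_le g id

theorem sum_adj (h : Context M B env k g) :
    Computes M B env
      (Code.sum Code.numNodes fun u => Code.sum Code.numNodes fun v => Code.adj u v)
      (∑ u, ∑ v, (if g.Adj u v then 1 else 0)) (6 + μ * (16 + 19 * μ)) := by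
  have hsum := (sum_adj_le (g := g)).trans h.sq_le
  refine (Computes.sum (Tf := 6 + 19 * μ) h.numNodes (fun env₁ idx₁ he₁ u hu => ?_) hsum).mono
    (le_of_eq (by ring))
  refine (Computes.sum (Tf := 9) (h.extend he₁).numNodes (fun env₂ idx₂ he₂ v hv => ?_) ?_).mono
    (le_of_eq (by ring))
  · exact ((h.extend he₁).extend he₂).adj (hu.extend he₂) hv
  · exact (single_le_sum (f := fun u => ∑ v, (if g.Adj u v then 1 else 0))
      (fun _ _ => Nat.zero_le _) (mem_univ u)).trans hsum

theorem starDistance (h : Context M B env k g) :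
    Computes M B env Code.starDistance
      ((∑ u, ∑ v, (if g.Adj u v then 1 else 0) + (k * (k - 1) + 2 * (μ - k)) -
        2 * maxStarOverlap g fun j : Fin k => evenShare (μ - k) k j) / 2)
      (37 + 12 * k + μ * (16 + 19 * μ) + μ ^ k * (2 * (μ * candidateTime k) + 11)) := by
  have hsq := h.six_mul_sq_le
  have hadj := sum_adj_le (g := g)
  have hcentres : k * (k - 1) ≤ μ ^ 2 := by
    rw [sq]
    exact Nat.mul_le_mul h.k_le ((Nat.sub_le ..).trans h.k_le)
  have hμ := Nat.le_self_pow two_ne_zero μ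
  have hmax := h.maxStarOverlap_le
  have hstar := Computes.add
    (.mul h.numCentres (.sub h.numCentres (.lit h.one_le)) fun _ _ => by omega)
    (.mul (.lit h.two_le) (.sub h.numNodes h.numCentres) fun _ _ => by omega)
    fun _ _ => by omega
  exact (Computes.div (.sub (.add h.sum_adj hstar fun _ _ => by omega)
    (.mul (.lit h.two_le) h.maxOverlap fun _ _ => by omega)) (.lit h.two_le)).mono (by omega)

end Context

/-- The program that computes the distance in register `2` and moves it to register `0`. -/
def starProgram : Program := Code.starDistance 2 0 ++ [.const 0 0, .add 0 0 2]

theorem input_mem_apply (k : ℕ) {μ : ℕ} (g : SimpleGraph (Fin μ)) [DecidableRel g.Adj]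
    (u v : Fin μ) : (input k g).mem (u * μ + v) = if g.Adj u v then 1 else 0 := by
  have hindex : (∃ i j : Fin μ, (u : ℕ) * μ + v = i * μ + j ∧ g.Adj i j) ↔ g.Adj u v := by
    refine ⟨fun ⟨i, j, hij, hadj⟩ => ?_, fun hadj => ⟨u, v, rfl, hadj⟩⟩
    have hpair : finProdFinEquiv (u, v) = finProdFinEquiv (i, j) := by
      ext
      simp only [finProdFinEquiv_apply_val]
      linarith
    obtain ⟨rfl, rfl⟩ := Prod.mk.inj (finProdFinEquiv.injective hpair)
    exact hadj
  simp only [input, hindex]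

theorem input_bounded {k μ B : ℕ} (g : SimpleGraph (Fin μ)) (hB : 1 ≤ B) (hk : k ≤ B)
    (hμ : μ ≤ B) : (input k g).Bounded B := by
  refine ⟨fun a => ?_, fun a => ?_⟩ <;> simp only [input] <;> split_ifs <;> omega

theorem input_state {k μ B : ℕ} {g : SimpleGraph (Fin μ)} (h : (input k g).Bounded B) :
    State (input k g).mem B (input k g) 0 [k, μ] := by
  refine ⟨rfl, rfl, h, fun i v hi => ?_⟩
  rcases i with _ | _ | i <;> simp_all [input]

/-- The constant of the time bound `O(μ ^ (k + 1))`, which also serves for the stored numbers. -/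
def timeConstant (k : ℕ) : ℕ := 85 + 12 * k + 2 * Context.candidateTime k + 2 ^ k

theorem input_context {k μ : ℕ} (hk : 1 ≤ k) (hμ : k ≤ μ) (g : SimpleGraph (Fin μ))
    [DecidableRel g.Adj] :
    Context (input k g).mem (timeConstant k * μ ^ (k + 1)) [k, μ] k g where
  k_pos := hk
  k_le := hμ
  mem_apply := input_mem_apply k g
  six_mul_sq_le := Nat.mul_le_mul (Nat.le_add_right_of_le (by omega))
    (Nat.pow_le_pow_right (hk.trans hμ) (by omega))
  pow_le := (Nat.pow_le_pow_right (hk.trans hμ) k.le_succ).trans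
    (Nat.le_mul_of_pos_left _ (Nat.le_add_right_of_le (by omega)))
  two_pow_le := (Nat.le_add_left ..).trans
    (Nat.le_mul_of_pos_right _ (Nat.pow_pos (hk.trans hμ)))
  prefix_env := List.prefix_refl _

theorem starProgram_haltsIn {k μ B : ℕ} {g : SimpleGraph (Fin μ)} [DecidableRel g.Adj]
    (h : Context (input k g).mem B [k, μ] k g) :
    ∃ t ≤ 39 + 12 * k + μ * (16 + 19 * μ) + μ ^ k * (2 * (μ * Context.candidateTime k) + 11),
      ∃ final, HaltsIn starProgram B t (input k g) final ∧
        final.reg 0 = (∑ u, ∑ v, (if g.Adj u v then 1 else 0) + (k * (k - 1) + 2 * (μ - k)) -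
          2 * maxStarOverlap g fun j : Fin k => evenShare (μ - k) k j) / 2 := by
  have hcode : CodeAt starProgram 0 (Code.starDistance 2 0 ++ [.const 0 0, .add 0 0 2]) :=
    ⟨[], [], (List.append_nil _).symm, rfl⟩
  have hdistance := h.starDistance _ (List.prefix_refl _) starProgram 0 hcode.left
  set d := (∑ u, ∑ v, (if g.Adj u v then 1 else 0) + (k * (k - 1) + 2 * (μ - k)) -
    2 * maxStarOverlap g fun j : Fin k => evenShare (μ - k) k j) / 2
  have hclear := Triple.const_set (M := (input k g).mem) (env := [k, μ, d]) hcode.right.head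
    (Nat.zero_le B)
  have hmove := Triple.binary_set (M := (input k g).mem) (B := B) (env := [0, μ, d]) (f := (· + ·))
    (v := 0) (w := d) (fun _ _ _ _ => rfl) hcode.right.tail.head rfl rfl
    fun _ hd => by simpa using hd
  have hstart := input_state (input_bounded g h.one_le (h.k_le.trans h.μ_le) h.μ_le)
  obtain ⟨t, ht, final, hsteps, hfinal⟩ := hdistance.trans (hclear.trans hmove) _ hstart
  refine ⟨t, ht.trans (by omega), final, hsteps.haltsIn ?_ hfinal.bounded, ?_⟩
  · rw [hfinal.pc]
    simp [starProgram]
  · simpa using hfinal.reg 0 (0 + d) rfl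

theorem starProgram_time_le {k μ : ℕ} (hk : 1 ≤ k) (hμ : 1 ≤ μ) :
    39 + 12 * k + μ * (16 + 19 * μ) + μ ^ k * (2 * (μ * Context.candidateTime k) + 11) ≤
      timeConstant k * μ ^ (k + 1) := by
  have hone := Nat.le_mul_of_pos_right (39 + 12 * k) (Nat.pow_pos (n := k + 1) hμ)
  have hsq : μ ^ 2 ≤ μ ^ (k + 1) := Nat.pow_le_pow_right hμ (by omega)
  have hpow : μ ^ k ≤ μ ^ (k + 1) := Nat.pow_le_pow_right hμ (Nat.le_succ k)
  have hself := Nat.le_self_pow two_ne_zero μ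
  calc 39 + 12 * k + μ * (16 + 19 * μ) + μ ^ k * (2 * (μ * Context.candidateTime k) + 11)
      = 39 + 12 * k + 16 * μ + 19 * μ ^ 2 + 2 * Context.candidateTime k * μ ^ (k + 1) +
          11 * μ ^ k := by ring
    _ ≤ (39 + 12 * k) * μ ^ (k + 1) + 16 * μ ^ (k + 1) + 19 * μ ^ (k + 1) +
          2 * Context.candidateTime k * μ ^ (k + 1) + 11 * μ ^ (k + 1) := by omega
    _ = (85 + 12 * k + 2 * Context.candidateTime k) * μ ^ (k + 1) := by ring
    _ ≤ timeConstant k * μ ^ (k + 1) := Nat.mul_le_mul_right _ (Nat.le_add_right ..)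

end RAM

theorem theorem3_general :
    ∃ P : RAM.Program, ∀ k : ℕ, 1 ≤ k →
      ∃ C c : ℕ, ∀ μ : ℕ, k ≤ μ → ∀ g : SimpleGraph (Fin μ),
        ∃ (t : ℕ) (final : RAM.Config),
          RAM.HaltsIn P (C * μ ^ c) t (RAM.input k g) final ∧
          t ≤ C * μ ^ (k + 1) ∧
          ∀ h : SimpleGraph (Fin μ), IsKStar k h →
            IsGraphEditDistance g h (final.reg 0) := by
  classical
  refine ⟨RAM.starProgram, fun k hk => ⟨RAM.timeConstant k, k + 1, fun μ hμ g => ?_⟩⟩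
  obtain ⟨t, ht, final, hhalts, hfinal⟩ := RAM.starProgram_haltsIn (RAM.input_context hk hμ g)
  refine ⟨t, final, hhalts, ht.trans (RAM.starProgram_time_le hk (hk.trans hμ)), fun h hh => ?_⟩
  rw [hfinal]
  simpa using hh.isGraphEditDistance (g := g)

theorem theorem3 :
    ∃ P : RAM.Program, ∀ k : ℕ, 1 ≤ k →
      ∃ C c : ℕ, ∀ μ : ℕ, k ≤ μ → ∀ g : SimpleGraph (Fin μ),
        ∃ (t : ℕ) (final : RAM.Config),
          RAM.HaltsIn P (C * μ ^ c) t (RAM.input k g) final ∧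
          t ≤ C * μ ^ (k + 2) ∧
          ∀ h : SimpleGraph (Fin μ), IsKStar k h →
            IsGraphEditDistance g h (final.reg 0) := by
  obtain ⟨P, hP⟩ := theorem3_general
  refine ⟨P, fun k hk => (hP k hk).imp fun C => .imp fun c hC μ hμ g => ?_⟩
  obtain ⟨t, final, hhalts, ht, hdist⟩ := hC μ hμ g
  exact ⟨t, final, hhalts, ht.trans (Nat.mul_le_mul_left C
    (Nat.pow_le_pow_right (hk.trans hμ) (k + 1).le_succ)), hdist⟩
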